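/- For integers $n\ge 1$, $m\ge 0$, the mean-field unit-rate zero-range process with $n$ sites and $m$ particles is the right-continuous Markov process $\eta(t)=(\eta_1(t),\dots,\eta_n(t))$, $t\ge 0$, on $\{x\in\mathbb Z_+^n : x_1+\dots+x_n=m\}$ with transition semigroup $P_t=e^{t\mathcal L}$, where $$(\mathcal L f)(x)=\frac1n\sum_{1\le i,j\le n}\mathbf 1_{(x_i>0)}\bigl(f(x+\delta^j-\delta^i)-f(x)\bigr),\qquad \delta^i_k=\mathbf 1_{(k=i)}.$$ Its empirical distribution is $Q(t)=\frac1n\sum_{i=1}^n\delta_{\eta_i(t)}$, seen as an element of $\ell^1(\mathbb Z_+)$ with norm $\|q\|=\sum_{k\ge 0}|q_k|$. Proposition (propagation of chaos). Consider a sequence of such processes along which $n\to\infty$ and $m/n\to\rho$ for some $\rho\in(0,\infty)$, and suppose that the initial empirical distribution $Q(0)$ converges in $\ell^1(\mathbb Z_+)$ to some probability distribution $q$ on $\mathbb Z_+$ (if the initial configurations are random, convergence in probability suffices). Then the $\ell^1(\mathbb Z_+)$-valued differential equation $$\frac{d\mathfrak q_k}{dt}=\mathfrak q_{k+1}-\mathfrak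 q_k\mathbf 1_{(k\ge 1)}-\Bigl(\sum_{\ell\ge 1}\mathfrak q_\ell\Bigr)\bigl(\mathfrak q_k-\mathfrak q_{k-1}\mathbf 1_{(k\ge 1)}\bigr),\qquad k\ge 0,$$ has exactly one solution $(\mathfrak q(t))_{t\ge 0}$ with $\mathfrak q(0)=q$, defined for all times $t\ge 0$, and for every fixed $T\ge 0$, $$\sup_{t\in[0,T]}\|Q(t)-\mathfrak q(t)\|\xrightarrow[n\to\infty]{}0\quad\text{in probability.}$$ -/

import Mathlib

open Set Filter Topology MeasureTheory
open scoped NNReal ENNReal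

noncomputable section

namespace ZeroRange

/-! ### The zero-range process on the complete graph -/

/-- Configurations of `m` indistinguishable particles on `n` sites: `x i` is the number of
particles at site `i`. The topology and the σ-algebra are the discrete ones. -/
abbrev Config (n m : ℕ) : Type := {x : Fin n → ℕ // ∑ i, x i = m}

/-- There are finitely many configurations. -/
instance instFintypeConfig (n m : ℕ) : Fintype (Config n m) :=
  Fintype.subtype (Finset.piAntidiag Finset.univ m) (by simp [Finset.mem_piAntidiag])

/-- Moving one particle from a non-empty site preserves the number of particles. -/
theorem sum_move {n m : ℕ} (x : Config n m) (i j : Fin n) (h : 0 < x.1 i) :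
    ∑ k, (x.1 + Pi.single j 1 - Pi.single i 1 : Fin n → ℕ) k = m := by
  have h1 : ∀ k, (x.1 + Pi.single j 1 - Pi.single i 1 : Fin n → ℕ) k + (if k = i then 1 else 0)
      = x.1 k + (if k = j then 1 else 0) := by
    intro k
    simp only [Pi.add_apply, Pi.sub_apply, Pi.single_apply]
    by_cases hk : k = i
    · subst hk
      simp only [if_true]
      omega
    · simp [hk]
  have h2 := Finset.sum_congr (rfl : (Finset.univ : Finset (Fin n)) = _) fun k _ => h1 k
  rw [Finset.sum_add_distrib, Finset.sum_add_distrib, x.2] at h2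
  simp only [Finset.sum_ite_eq', Finset.mem_univ, if_true] at h2
  omega

/-- The configuration `x + δʲ - δⁱ` obtained by moving one particle from the non-empty site `i`
to the site `j`. -/
def move {n m : ℕ} (x : Config n m) (i j : Fin n) (h : 0 < x.1 i) : Config n m :=
  ⟨x.1 + Pi.single j 1 - Pi.single i 1, sum_move x i j h⟩

/-- The Markov generator acting on observables:
`(L f)(x) = (1/n) ∑_{i,j} 1_{x i > 0} (f (x + δʲ - δⁱ) - f x)`. -/
def generatorLin (n m : ℕ) : (Config n m → ℝ) →ₗ[ℝ] (Config n m → ℝ) where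
  toFun f x := (1 / (n : ℝ)) * ∑ i, ∑ j, if h : 0 < x.1 i then f (move x i j h) - f x else 0
  map_add' f g := by
    funext x
    simp only [Pi.add_apply, ← mul_add, ← Finset.sum_add_distrib]
    congr 1
    refine Finset.sum_congr rfl fun i _ => Finset.sum_congr rfl fun j _ => ?_
    split_ifs <;> ring
  map_smul' c f := by
    funext x
    simp only [Pi.smul_apply, smul_eq_mul, RingHom.id_apply, Finset.mul_sum]
    refine Finset.sum_congr rfl fun i _ => Finset.sum_congr rfl fun j _ => ?_
    split_ifs <;> ring

/-- The generator as a bounded operator on the finite-dimensional space of observables. -/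
def generator (n m : ℕ) : (Config n m → ℝ) →L[ℝ] (Config n m → ℝ) :=
  LinearMap.toContinuousLinearMap (generatorLin n m)

/-- The transition semigroup `P_t = exp (t L)`. -/
def semigroup (n m : ℕ) (t : ℝ) : (Config n m → ℝ) →L[ℝ] (Config n m → ℝ) :=
  NormedSpace.exp (t • generator n m)

/-- The past `σ(η(u) : u ≤ s)` of a process. -/
@[reducible]
def history {Ω S : Type*} [MeasurableSpace S] (η : ℝ≥0 → Ω → S) (s : ℝ≥0) : MeasurableSpace Ω :=
  ⨆ u ≤ s, MeasurableSpace.comap (η u) inferInstance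

/-- `η` is a (mean-field, unit-rate) zero-range process with `n` sites and `m` particles on the
probability space `(Ω, P)`: a right-continuous Markov process with transition semigroup
`exp (t L)`. Its initial law is arbitrary. -/
structure IsZeroRangeProcess {Ω : Type*} [MeasurableSpace Ω] (n m : ℕ) (P : Measure Ω)
    (η : ℝ≥0 → Ω → Config n m) : Prop where
  measurable : ∀ t, Measurable (η t)
  rightContinuous : ∀ ω t, ContinuousWithinAt (fun s => η s ω) (Ici t) t
  markov : ∀ (f : Config n m → ℝ) (s t : ℝ≥0),
    P[fun ω => f (η (s + t) ω) | history η s] =ᵐ[P] fun ω => semigroup n m t f (η s ω)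

/-! ### Empirical distributions and the fluid equation -/

/-- The Banach space `ℓ¹(ℤ₊)`. -/
abbrev EllOne : Type := lp (fun _ : ℕ => ℝ) 1

/-- The empirical distribution `(1/n) ∑ᵢ δ_{x i}` of a configuration, as an element of `ℓ¹`. -/
def empirical {n m : ℕ} (x : Config n m) : EllOne :=
  (1 / (n : ℝ)) • ∑ i, lp.single (E := fun _ : ℕ => ℝ) 1 (x.1 i) (1 : ℝ)

/-- The coordinates of the drift:
`F_k(q) = q_{k+1} - q_k 1_{k ≥ 1} - (∑_{ℓ ≥ 1} q_ℓ) (q_k - q_{k-1} 1_{k ≥ 1})`. -/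
def driftCoord (q : ℕ → ℝ) (k : ℕ) : ℝ :=
  q (k + 1) - (if 1 ≤ k then q k else 0)
    - (∑' l : ℕ, q (l + 1)) * (q k - (if 1 ≤ k then q (k - 1) else 0))

theorem memlp_driftCoord (q : EllOne) : Memℓp (E := fun _ : ℕ => ℝ) (driftCoord q) 1 := by
  have hq : Memℓp (E := fun _ : ℕ => ℝ) (fun k => q k) 1 := lp.memℓp q
  have key : ∀ f : ℕ → ℝ, Memℓp (E := fun _ : ℕ => ℝ) f 1 ↔ Summable fun k => ‖f k‖ := by
    intro f
    rw [memℓp_gen_iff (by simp)]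
    simp
  rw [key] at hq
  have h1 : Memℓp (E := fun _ : ℕ => ℝ) (fun k => q (k + 1)) 1 :=
    (key _).2 ((summable_nat_add_iff 1).2 hq)
  have h2 : Memℓp (E := fun _ : ℕ => ℝ) (fun k => if 1 ≤ k then q k else 0) 1 := by
    refine (key _).2 (Summable.of_nonneg_of_le (fun _ => norm_nonneg _) (fun k => ?_) hq)
    split_ifs <;> simp
  have h3 : Memℓp (E := fun _ : ℕ => ℝ) (fun k => if 1 ≤ k then q (k - 1) else 0) 1 := by
    refine (key _).2 ((summable_nat_add_iff 1).1 ?_)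
    simpa using hq
  exact (h1.sub h2).sub ((((key _).2 hq).sub h3).const_mul (∑' l : ℕ, q (l + 1)))

/-- The drift `F : ℓ¹ → ℓ¹`. -/
def drift (q : EllOne) : EllOne := ⟨driftCoord q, memlp_driftCoord q⟩

/-- `u : [0, ∞) → ℓ¹` is a global solution of the `ℓ¹`-valued Cauchy problem `u' = F(u)`,
`u(0) = q` (the values of `u` at negative times are irrelevant). -/
structure IsFluidSolution (q : EllOne) (u : ℝ → EllOne) : Prop where
  init : u 0 = q
  deriv : ∀ t : ℝ, 0 ≤ t → HasDerivWithinAt u (drift (u t)) (Ici 0) t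

/-! ### Convergence in probability -/

/-- Convergence to `0` in probability of a sequence of non-negative random variables, each one
living on its own probability space. -/
def TendstoZeroInProb {Ω : ℕ → Type*} [∀ k, MeasurableSpace (Ω k)] (P : ∀ k, Measure (Ω k))
    (X : ∀ k, Ω k → ℝ≥0∞) : Prop :=
  ∀ ε : ℝ≥0∞, 0 < ε → Tendsto (fun k => P k {ω | ε ≤ X k ω}) atTop (𝓝 0)

end ZeroRange

end

/-! The frequency of sites holding `k` particles is a semimartingale whose drift is that of the
fluid equation and whose noise vanishes as `n` grows. A jump changes a frequency by at most `2 / n`,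
and jumps occur at rate at most `n`, so the variance rate is `O(1 / n)`
(`carre_du_champ_siteAverage_le`). The generator produces the fluid drift up to the diagonal pairs
`i = j`, an `O(1 / n)` error (`abs_generator_empirical_sub_drift_le`). Finitely many frequencies
suffice in `ℓ¹`, because Markov's inequality bounds the mass above level `K` by `m / (n K)`.

Time is discretised with step `T / N` and the process fixed. Kolmogorov's inequality controls the
discrete Dynkin martingales (`measure_max_dynkin_le`), so off a small event the empirical
distributions follow a perturbed Euler scheme (`norm_empirical_sub_euler_le`), and a discrete
Gronwall argument compares it with the solution (`norm_sub_le_of_euler`). Letting `N → ∞` along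
dyadic grids, right-continuity gives the supremum over all times (`measure_sup_le`).

The drift is quadratic, hence only locally Lipschitz. It is therefore precomposed with a retraction
onto the unit ball, where empirical distributions live anyway. The cut-off equation has a global
solution; being a limit of empirical distributions, this solution stays in the unit ball, and so
solves the original equation. -/

noncomputable section

namespace ZeroRange

/-! ### Ordinary differential equations -/

/-- A bounded Lipschitz vector field on a Banach space has a global forward solution. -/
theorem exists_global_solution {E : Type*} [NormedAddCommGroup E] [NormedSpace ℝ E]
    [CompleteSpace E] {G : E → E} {K C : ℝ≥0} (hG : LipschitzWith K G) (hC : ∀ x, ‖G x‖ ≤ C)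
    (x : E) :
    ∃ u : ℝ → E, u 0 = x ∧ ∀ t, 0 ≤ t → HasDerivWithinAt u (G (u t)) (Ici 0) t := by
  have hloc : ∀ N : ℕ, ∃ u : ℝ → E, u 0 = x ∧
      ∀ t ∈ Icc (0 : ℝ) N, HasDerivWithinAt u (G (u t)) (Icc 0 N) t := by
    intro N
    -- The speed is at most `C`, so up to time `N` the solution stays within `C * N` of `x`; the
    -- Lipschitz bound is global, so this radius costs nothing.
    have h : IsPicardLindelof (fun _ : ℝ => G) (⟨0, by simp⟩ : Icc (0 : ℝ) N) x (C * N) 0 C K :=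
      { lipschitzOnWith := fun _ _ => hG.lipschitzOnWith
        continuousOn := fun _ _ => continuousOn_const
        norm_le := fun _ _ y _ => hC y
        mul_max_le := by simp }
    exact h.exists_eq_forall_mem_Icc_hasDerivWithinAt₀
  choose v hv0 hv using hloc
  have agree : ∀ M N : ℕ, M ≤ N → EqOn (v M) (v N) (Icc 0 M) := by
    intro M N hMN
    have hsub : Icc (0 : ℝ) M ⊆ Icc 0 N := Icc_subset_Icc_right (by exact_mod_cast hMN)
    have right : ∀ (R : ℕ), M ≤ R → ∀ t ∈ Ico (0 : ℝ) M,
        HasDerivWithinAt (v R) (G (v R t)) (Ici t) t := by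
      intro R hR t ht
      have hR' : (M : ℝ) ≤ R := by exact_mod_cast hR
      refine (hv R t ⟨ht.1, ht.2.le.trans hR'⟩).mono_of_mem_nhdsWithin ?_
      exact mem_of_superset (Icc_mem_nhdsGE (ht.2.trans_le hR')) (Icc_subset_Icc_left ht.1)
    refine ODE_solution_unique_of_mem_Icc_right (v := fun _ => G) (s := fun _ => univ) (K := K)
      (fun _ _ => hG.lipschitzOnWith) (fun t ht => (hv M t ht).continuousWithinAt)
      (right M le_rfl) (fun _ _ => mem_univ _)
      (fun t ht => ((hv N t (hsub ht)).mono hsub).continuousWithinAt)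
      (right N hMN) (fun _ _ => mem_univ _) (by rw [hv0, hv0])
  -- The `+ 1` puts `t` strictly before the right end of the interval, so the one-sided derivative
  -- within it is the derivative within `Ici 0`.
  refine ⟨fun t => v (⌊t⌋₊ + 1) t, by simp [hv0], fun t ht => ?_⟩
  have htN : t < (⌊t⌋₊ + 1 : ℕ) := by exact_mod_cast Nat.lt_floor_add_one t
  have heq : EqOn (fun s => v (⌊s⌋₊ + 1) s) (v (⌊t⌋₊ + 1)) (Icc 0 (⌊t⌋₊ + 1 : ℕ)) := by
    intro s hs
    have hsN : s < (⌊s⌋₊ + 1 : ℕ) := by exact_mod_cast Nat.lt_floor_add_one s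
    rcases le_total (⌊s⌋₊ + 1) (⌊t⌋₊ + 1) with h | h
    · exact agree _ _ h ⟨hs.1, hsN.le⟩
    · exact (agree _ _ h hs).symm
  have hmem : Icc (0 : ℝ) (⌊t⌋₊ + 1 : ℕ) ∈ 𝓝[Ici 0] t := by
    rw [← Ici_inter_Iic]
    exact inter_mem_nhdsWithin _ (Iic_mem_nhds htN)
  exact (((hv _ t ⟨ht, htN.le⟩).congr heq (heq ⟨ht, htN.le⟩)).mono_of_mem_nhdsWithin hmem)

/-- Projection onto the unit ball along rays. -/
def radialProj {E : Type*} [NormedAddCommGroup E] [NormedSpace ℝ E] (x : E) : E :=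
  (max 1 ‖x‖)⁻¹ • x

section radialProj

variable {E : Type*} [NormedAddCommGroup E] [NormedSpace ℝ E]

theorem norm_radialProj_le (x : E) : ‖radialProj x‖ ≤ 1 := by
  have h : 0 < max 1 ‖x‖ := lt_of_lt_of_le one_pos (le_max_left _ _)
  rw [radialProj, norm_smul, norm_inv, Real.norm_of_nonneg h.le, inv_mul_le_iff₀ h, mul_one]
  exact le_max_right _ _

theorem radialProj_of_norm_le {x : E} (h : ‖x‖ ≤ 1) : radialProj x = x := by
  simp [radialProj, max_eq_left h]

/-- The difference splits into a rescaling of `x - y` and a change of scale applied to `y`. Each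
costs at most `‖x - y‖`, because the scales are at least one and `‖y‖` is at most its own scale. -/
theorem norm_radialProj_sub_le (x y : E) : ‖radialProj x - radialProj y‖ ≤ 2 * ‖x - y‖ := by
  set a := max 1 ‖x‖ with ha
  set b := max 1 ‖y‖ with hb
  have ha1 : 1 ≤ a := le_max_left _ _
  have hb1 : 1 ≤ b := le_max_left _ _
  have hyb : ‖y‖ ≤ b := le_max_right _ _
  have hab : |b - a| ≤ ‖x - y‖ := by
    calc |b - a| ≤ |‖y‖ - ‖x‖| := by
          simpa using abs_max_sub_max_le_max 1 ‖y‖ 1 ‖x‖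
      _ ≤ ‖y - x‖ := abs_norm_sub_norm_le _ _
      _ = ‖x - y‖ := norm_sub_rev _ _
  have key : radialProj x - radialProj y = a⁻¹ • (x - y) + ((b - a) * (a⁻¹ * b⁻¹)) • y := by
    have : (b - a) * (a⁻¹ * b⁻¹) = a⁻¹ - b⁻¹ := by field_simp
    rw [this, radialProj, radialProj, ← ha, ← hb]
    module
  have h1 : ‖a⁻¹ • (x - y)‖ ≤ ‖x - y‖ := by
    rw [norm_smul, norm_inv, Real.norm_of_nonneg (by positivity)]
    exact mul_le_of_le_one_left (norm_nonneg _) (inv_le_one_of_one_le₀ ha1)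
  have h2 : ‖((b - a) * (a⁻¹ * b⁻¹)) • y‖ ≤ ‖x - y‖ := by
    rw [norm_smul, Real.norm_eq_abs, abs_mul, mul_assoc]
    have : |a⁻¹ * b⁻¹| * ‖y‖ ≤ 1 := by
      rw [abs_of_pos (by positivity), mul_assoc]
      have h3 : b⁻¹ * ‖y‖ ≤ 1 := by rw [inv_mul_le_iff₀ (by positivity)]; simpa using hyb
      exact mul_le_one₀ (inv_le_one_of_one_le₀ ha1) (by positivity) h3
    exact (mul_le_of_le_one_right (abs_nonneg _) this).trans hab
  rw [key]
  linarith [norm_add_le (a⁻¹ • (x - y)) (((b - a) * (a⁻¹ * b⁻¹)) • y)]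

end radialProj

/-- One step of the Euler scheme for `u' = G(u)` has a quadratic local error. -/
theorem norm_euler_sub_le {E : Type*} [NormedAddCommGroup E] [NormedSpace ℝ E]
    {G : E → E} {K C : ℝ≥0} (hG : LipschitzWith K G) (hC : ∀ x, ‖G x‖ ≤ C) {u : ℝ → E}
    (hu : ∀ t, 0 ≤ t → HasDerivWithinAt u (G (u t)) (Ici 0) t) {t h : ℝ} (ht : 0 ≤ t)
    (hh : 0 ≤ h) : ‖u (t + h) - u t - h • G (u t)‖ ≤ K * C * h ^ 2 := by
  have hder : ∀ s, t ≤ s → HasDerivWithinAt u (G (u s)) (Ici s) s := fun s hs =>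
    (hu s (ht.trans hs)).mono (Ici_subset_Ici.2 (ht.trans hs))
  have hcont : ContinuousOn u (Icc t (t + h)) := fun s hs =>
    ((hu s (ht.trans hs.1)).continuousWithinAt).mono fun r hr => ht.trans hr.1
  have hlip : ∀ s ∈ Icc t (t + h), ‖u s - u t‖ ≤ C * (s - t) :=
    norm_image_sub_le_of_norm_deriv_right_le_segment hcont (fun s hs => hder s hs.1)
      (fun s _ => hC _)
  have hder2 : ∀ s ∈ Ico t (t + h), HasDerivWithinAt (fun s => u s - (s - t) • G (u t))
      (G (u s) - G (u t)) (Ici s) s := fun s hs => by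
    have := (hder s hs.1).sub
      ((((hasDerivAt_id s).sub_const t).smul_const (G (u t))).hasDerivWithinAt (s := Ici s))
    rw [one_smul] at this
    exact this
  -- Subtracting the tangent leaves the derivative `G (u s) - G (u t)`, at most `K * ‖u s - u t‖ ≤ K
  -- * (C * h)`.
  have := norm_image_sub_le_of_norm_deriv_right_le_segment (C := K * (C * h))
    (hcont.sub (((continuous_id.sub continuous_const).smul continuous_const).continuousOn)) hder2
    (fun s hs => by
      refine (hG.norm_sub_le _ _).trans ?_
      gcongr
      refine (hlip s ⟨hs.1, hs.2.le⟩).trans ?_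
      gcongr
      linarith [hs.2]) (t + h) ⟨by linarith, le_rfl⟩
  have e : u (t + h) - u t - h • G (u t)
      = (u (t + h) - (t + h - t) • G (u t)) - (u t - (t - t) • G (u t)) := by
    simp; abel
  rw [e]
  refine this.trans (le_of_eq ?_)
  ring

/-- Comparison of a discrete perturbed Euler scheme with a solution of `u' = G(u)`. -/
theorem norm_sub_le_of_euler {E : Type*} [NormedAddCommGroup E] [NormedSpace ℝ E]
    {G : E → E} {K C : ℝ≥0} (hG : LipschitzWith K G) (hC : ∀ x, ‖G x‖ ≤ C) {u : ℝ → E}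
    (hu : ∀ t, 0 ≤ t → HasDerivWithinAt u (G (u t)) (Ici 0) t) {h : ℝ} (hh : 0 ≤ h)
    (w : ℕ → E) {N : ℕ} {r : ℝ}
    (hw : ∀ i ≤ N, ‖w i - w 0 - ∑ j ∈ Finset.range i, h • G (w j)‖ ≤ r) {i : ℕ} (hi : i ≤ N) :
    ‖w i - u (i * h)‖ ≤
      (‖w 0 - u 0‖ + r + N * (K * C * h ^ 2)) * Real.exp (K * (N * h)) := by
  have hr : 0 ≤ r := (norm_nonneg _).trans (hw 0 (Nat.zero_le _))
  set a : ℝ := ‖w 0 - u 0‖ + r + N * (K * C * h ^ 2) with ha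
  have ha0 : 0 ≤ a := by positivity
  have hu' : ∀ i : ℕ, ‖u (i * h) - u 0 - ∑ j ∈ Finset.range i, h • G (u (j * h))‖ ≤
      i * (K * C * h ^ 2) := by
    intro i
    induction i with
    | zero => simp
    | succ i ih =>
      rw [Finset.sum_range_succ]
      have e := norm_euler_sub_le hG hC hu (t := i * h) (h := h) (by positivity) hh
      have e2 : u ((i + 1 : ℕ) * h) - u 0 -
          (∑ j ∈ Finset.range i, h • G (u (j * h)) + h • G (u (i * h))) =
          (u (i * h) - u 0 - ∑ j ∈ Finset.range i, h • G (u (j * h))) +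
          (u (i * h + h) - u (i * h) - h • G (u (i * h))) := by
        rw [show ((i + 1 : ℕ) : ℝ) * h = i * h + h by push_cast; ring]; abel
      rw [e2]
      refine (norm_add_le _ _).trans ?_
      push_cast
      linarith
  have step : ∀ i ≤ N, ‖w i - u (i * h)‖ ≤
      a + ∑ j ∈ Finset.range i, K * h * ‖w j - u (j * h)‖ := by
    intro i hi
    have e : w i - u (i * h) = (w 0 - u 0) + (w i - w 0 - ∑ j ∈ Finset.range i, h • G (w j))
        - (u (i * h) - u 0 - ∑ j ∈ Finset.range i, h • G (u (j * h)))
        + ∑ j ∈ Finset.range i, h • (G (w j) - G (u (j * h))) := by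
      simp only [smul_sub, Finset.sum_sub_distrib]; abel
    have h3 : ‖∑ j ∈ Finset.range i, h • (G (w j) - G (u (j * h)))‖ ≤
        ∑ j ∈ Finset.range i, K * h * ‖w j - u (j * h)‖ := by
      refine norm_sum_le_of_le _ fun j _ => ?_
      rw [norm_smul, Real.norm_of_nonneg hh, mul_comm (K : ℝ), mul_assoc]
      gcongr
      exact hG.norm_sub_le _ _
    have h4 : (i : ℝ) * (K * C * h ^ 2) ≤ N * (K * C * h ^ 2) := by gcongr
    rw [e]
    refine (norm_add_le _ _).trans (add_le_add ?_ h3)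
    refine (norm_sub_le _ _).trans ?_
    refine (add_le_add (norm_add_le _ _) (hu' i)).trans ?_
    rw [ha]
    exact add_le_add (add_le_add le_rfl (hw i hi)) h4
  -- Discrete Gronwall: the geometric sum makes the bound `a * (1 + K * h) ^ i` reproduce itself.
  have main : ∀ i ≤ N, ‖w i - u (i * h)‖ ≤ a * (1 + K * h) ^ i := by
    intro i
    induction i using Nat.strong_induction_on with
    | _ i ih =>
      intro hi
      refine (step i hi).trans ?_
      have : ∑ j ∈ Finset.range i, K * h * ‖w j - u (j * h)‖ ≤
          ∑ j ∈ Finset.range i, K * h * (a * (1 + K * h) ^ j) := by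
        refine Finset.sum_le_sum fun j hj => ?_
        have hj' := Finset.mem_range.1 hj
        exact mul_le_mul_of_nonneg_left (ih j hj' (hj'.le.trans hi)) (by positivity)
      refine (add_le_add le_rfl this).trans (le_of_eq ?_)
      have geo : (K * h) * ∑ j ∈ Finset.range i, (1 + K * h) ^ j = (1 + K * h) ^ i - 1 := by
        have := mul_geom_sum (1 + K * h) i
        simpa using this
      calc a + ∑ j ∈ Finset.range i, K * h * (a * (1 + K * h) ^ j)
          = a + a * ((K * h) * ∑ j ∈ Finset.range i, (1 + K * h) ^ j) := by
            simp only [Finset.mul_sum]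
            congr 1
            exact Finset.sum_congr rfl fun j _ => by ring
        _ = a * (1 + K * h) ^ i := by rw [geo]; ring
  refine (main i hi).trans ?_
  gcongr
  calc (1 + K * h) ^ i ≤ Real.exp (K * h) ^ i := by
        gcongr
        linarith [Real.add_one_le_exp (K * h)]
    _ = Real.exp (i * (K * h)) := (Real.exp_nat_mul _ _).symm
    _ ≤ Real.exp (K * (N * h)) := by
        apply Real.exp_le_exp.2
        have : (i : ℝ) ≤ N := by exact_mod_cast hi
        have : (i : ℝ) * (K * h) ≤ N * (K * h) := by gcongr
        linarith

/-! ### The drift on `ℓ¹` -/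

namespace EllOne

theorem hasSum_abs (q : EllOne) : HasSum (fun k => |q k|) ‖q‖ := by
  simpa using lp.hasSum_norm (p := 1) (by simp) q

theorem summable (q : EllOne) : Summable fun k => q k := (hasSum_abs q).summable.of_abs

theorem memlp_of_summable {f : ℕ → ℝ} (hf : Summable fun k => |f k|) :
    Memℓp (E := fun _ : ℕ => ℝ) f 1 := by
  rw [memℓp_gen_iff (by simp)]
  simpa using hf

/-- The left shift `(q₀, q₁, …) ↦ (q₁, q₂, …)`. -/
def shiftLeft : EllOne →L[ℝ] EllOne :=
  LinearMap.mkContinuous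
    { toFun := fun q => ⟨fun k => q (k + 1),
        memlp_of_summable ((summable_nat_add_iff 1).2 (hasSum_abs q).summable)⟩
      map_add' := fun _ _ => rfl
      map_smul' := fun _ _ => rfl } 1 fun q => by
    have h := (hasSum_abs q).summable.sum_add_tsum_nat_add 1
    rw [(hasSum_abs q).tsum_eq] at h
    rw [← (hasSum_abs _).tsum_eq, one_mul, ← h, Finset.sum_range_one]
    exact le_add_of_nonneg_left (abs_nonneg _)

@[simp]
theorem shiftLeft_apply (q : EllOne) (k : ℕ) : shiftLeft q k = q (k + 1) := rfl

theorem norm_shiftLeft_le (q : EllOne) : ‖shiftLeft q‖ ≤ ‖q‖ := by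
  simpa using shiftLeft.le_of_opNorm_le (LinearMap.mkContinuous_norm_le _ zero_le_one _) q

/-- The right shift `(q₀, q₁, …) ↦ (0, q₀, q₁, …)`. -/
def shiftRight : EllOne →L[ℝ] EllOne :=
  LinearMap.mkContinuous
    { toFun := fun q => ⟨fun k => if 1 ≤ k then q (k - 1) else 0,
        memlp_of_summable ((summable_nat_add_iff 1).1 (by simpa using (hasSum_abs q).summable))⟩
      map_add' := fun p q => by
        ext k
        show (if 1 ≤ k then p (k - 1) + q (k - 1) else 0) =
          (if 1 ≤ k then p (k - 1) else 0) + (if 1 ≤ k then q (k - 1) else 0)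
        split_ifs <;> simp
      map_smul' := fun c q => by
        ext k
        show (if 1 ≤ k then c * q (k - 1) else 0) = c * (if 1 ≤ k then q (k - 1) else 0)
        split_ifs <;> simp } 1 fun q => by
    set p : EllOne := ⟨fun k => if 1 ≤ k then q (k - 1) else 0, _⟩
    have h := (hasSum_abs p).summable.sum_add_tsum_nat_add 1
    rw [(hasSum_abs p).tsum_eq] at h
    show ‖p‖ ≤ _
    rw [← (hasSum_abs q).tsum_eq, one_mul, ← h]
    simp [p]

theorem shiftRight_apply (q : EllOne) (k : ℕ) :
    shiftRight q k = if 1 ≤ k then q (k - 1) else 0 := rfl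

theorem norm_shiftRight_le (q : EllOne) : ‖shiftRight q‖ ≤ ‖q‖ := by
  simpa using shiftRight.le_of_opNorm_le (LinearMap.mkContinuous_norm_le _ zero_le_one _) q

theorem shiftLeft_shiftRight (q : EllOne) : shiftLeft (shiftRight q) = q := by
  ext k
  simp [shiftRight_apply]

/-- The sum of the positive-index coordinates. -/
def busy : EllOne →L[ℝ] ℝ :=
  LinearMap.mkContinuous
    { toFun := fun q => ∑' l, q (l + 1)
      map_add' := fun p q =>
        ((summable_nat_add_iff 1).2 (summable p)).tsum_add ((summable_nat_add_iff 1).2 (summable q))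
      map_smul' := fun c q => tsum_mul_left } 1 fun q => by
    rw [one_mul]
    refine le_trans ?_ (norm_shiftLeft_le q)
    rw [← (hasSum_abs (shiftLeft q)).tsum_eq]
    exact norm_tsum_le_tsum_norm (hasSum_abs (shiftLeft q)).summable

theorem busy_apply (q : EllOne) : busy q = ∑' l, q (l + 1) := rfl

theorem abs_busy_le (q : EllOne) : |busy q| ≤ ‖q‖ := by
  simpa using busy.le_of_opNorm_le (LinearMap.mkContinuous_norm_le _ zero_le_one _) q

/-- Splits the norm into a head, controlled coordinate by coordinate, and a tail, controlled through
the mean number of particles per site. -/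
theorem norm_eq_sum_add_norm_shift (q : EllOne) (K : ℕ) :
    ‖q‖ = ∑ k ∈ Finset.range K, |q k| + ‖(shiftLeft ^ K) q‖ := by
  have hpow : ∀ (K : ℕ) (q : EllOne) (k : ℕ), (shiftLeft ^ K) q k = q (k + K) := by
    intro K
    induction K with
    | zero => intro q k; rfl
    | succ K ih =>
      intro q k
      rw [pow_succ, mul_apply_eq_comp, ih, shiftLeft_apply]
      rfl
  rw [← (hasSum_abs q).tsum_eq, ← (hasSum_abs ((shiftLeft ^ K) q)).tsum_eq]
  simp only [hpow]
  exact ((hasSum_abs q).summable.sum_add_tsum_nat_add K).symm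

theorem shiftLeft_pow_single_of_lt {a K : ℕ} (h : a < K) :
    (shiftLeft ^ K) (lp.single (E := fun _ : ℕ => ℝ) 1 a (1 : ℝ)) = 0 := by
  have h1 := norm_eq_sum_add_norm_shift (lp.single (E := fun _ : ℕ => ℝ) 1 a (1 : ℝ)) K
  rw [lp.norm_single (by simp), Finset.sum_eq_single_of_mem a (Finset.mem_range.2 h)] at h1
  · simpa using h1
  · intro b _ hb
    simp [lp.single_apply, hb]

theorem norm_shiftLeft_pow_succ_le (q : EllOne) (K : ℕ) :
    ‖(shiftLeft ^ (K + 1)) q‖ ≤ ‖(shiftLeft ^ K) q‖ := by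
  rw [pow_succ', mul_apply_eq_comp]
  exact norm_shiftLeft_le _

theorem norm_shiftLeft_pow_le (q : EllOne) (K : ℕ) : ‖(shiftLeft ^ K) q‖ ≤ ‖q‖ := by
  induction K with
  | zero => simp
  | succ K ih => exact (norm_shiftLeft_pow_succ_le q K).trans ih

end EllOne

open EllOne

/-- Exhibits the drift as a linear part plus a product of bounded linear maps. The composition
`shiftRight ∘ shiftLeft` erases coordinate zero, which accounts for the indicator of `k ≥ 1`. -/
theorem drift_eq (q : EllOne) :
    drift q = (shiftLeft q - shiftRight (shiftLeft q)) - busy q • (q - shiftRight q) := by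
  ext k
  show driftCoord q k = _
  simp only [driftCoord, lp.coeFn_sub, lp.coeFn_smul, Pi.sub_apply, Pi.smul_apply, smul_eq_mul,
    shiftLeft_apply, shiftRight_apply, busy_apply]
  rcases k with _ | k <;> simp

/-- The linear part contributes `2`; polarising the quadratic part gives two terms, each
contributing `2 * r`. -/
theorem norm_drift_sub_le {r : ℝ} {p q : EllOne} (hp : ‖p‖ ≤ r) (hq : ‖q‖ ≤ r) :
    ‖drift p - drift q‖ ≤ (2 + 4 * r) * ‖p - q‖ := by
  have hr : 0 ≤ r := (norm_nonneg _).trans hp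
  have e : drift p - drift q = (shiftLeft (p - q) - shiftRight (shiftLeft (p - q)))
      - busy (p - q) • (p - shiftRight p) - busy q • ((p - q) - shiftRight (p - q)) := by
    rw [drift_eq, drift_eq]
    simp only [map_sub]
    module
  have h1 : ‖shiftLeft (p - q) - shiftRight (shiftLeft (p - q))‖ ≤ 2 * ‖p - q‖ := by
    refine (norm_sub_le _ _).trans ?_
    linarith [norm_shiftLeft_le (p - q), norm_shiftRight_le (shiftLeft (p - q))]
  have hB : ∀ x : EllOne, ‖x - shiftRight x‖ ≤ 2 * ‖x‖ := fun x => by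
    refine (norm_sub_le _ _).trans ?_
    linarith [norm_shiftRight_le x]
  have h2 : ‖busy (p - q) • (p - shiftRight p)‖ ≤ ‖p - q‖ * (2 * r) := by
    rw [norm_smul]
    exact mul_le_mul (abs_busy_le _) ((hB p).trans (by linarith)) (norm_nonneg _) (norm_nonneg _)
  have h3 : ‖busy q • ((p - q) - shiftRight (p - q))‖ ≤ r * (2 * ‖p - q‖) := by
    rw [norm_smul]
    exact mul_le_mul ((abs_busy_le _).trans hq) (hB _) (norm_nonneg _) hr
  rw [e]
  refine (norm_sub_le _ _).trans ((add_le_add (norm_sub_le _ _) le_rfl).trans ?_)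
  linarith

theorem drift_zero : drift 0 = 0 := by
  simp [drift_eq]

theorem norm_drift_le {q : EllOne} (hq : ‖q‖ ≤ 1) : ‖drift q‖ ≤ 6 := by
  have := norm_drift_sub_le (p := q) (q := 0) hq (by simp)
  rw [drift_zero, sub_zero, sub_zero] at this
  linarith

/-- Occupation numbers move by one unit, so the drift above level `K + 1` only sees mass above level
`K`. Departures and arrivals contribute two terms each. -/
theorem norm_shiftLeft_pow_drift_le {q : EllOne} (hq : ‖q‖ ≤ 1) (K : ℕ) :
    ‖(shiftLeft ^ (K + 1)) (drift q)‖ ≤ 4 * ‖(shiftLeft ^ K) q‖ := by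
  have hR : ∀ x, (shiftLeft ^ (K + 1)) (shiftRight x) = (shiftLeft ^ K) x := fun x => by
    rw [pow_succ, mul_apply_eq_comp, shiftLeft_shiftRight]
  have hL : (shiftLeft ^ K) (shiftLeft q) = (shiftLeft ^ (K + 1)) q := by
    rw [pow_succ, mul_apply_eq_comp]
  have hL' : (shiftLeft ^ (K + 1)) (shiftLeft q) = (shiftLeft ^ (K + 2)) q := by
    rw [pow_succ _ (K + 1), mul_apply_eq_comp]
  have h1 := norm_shiftLeft_pow_succ_le q K
  have h2 := norm_shiftLeft_pow_succ_le q (K + 1)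
  rw [drift_eq, map_sub, map_sub, map_smul, map_sub, hR, hR, hL, hL']
  have h3 : ‖busy q • ((shiftLeft ^ (K + 1)) q - (shiftLeft ^ K) q)‖ ≤
      1 * (2 * ‖(shiftLeft ^ K) q‖) := by
    rw [norm_smul]
    refine mul_le_mul ((abs_busy_le q).trans hq) ?_ (norm_nonneg _) zero_le_one
    exact (norm_sub_le _ _).trans (by linarith)
  refine (norm_sub_le _ _).trans ((add_le_add (norm_sub_le _ _) h3).trans ?_)
  linarith

/-- The drift composed with the radial projection onto the unit ball: a bounded, globally Lipschitz
vector field which agrees with the drift on the unit ball. -/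
def cutoffDrift (q : EllOne) : EllOne := drift (radialProj q)

theorem cutoffDrift_of_norm_le {q : EllOne} (hq : ‖q‖ ≤ 1) : cutoffDrift q = drift q := by
  rw [cutoffDrift, radialProj_of_norm_le hq]

theorem norm_cutoffDrift_le (q : EllOne) : ‖cutoffDrift q‖ ≤ (6 : ℝ≥0) :=
  norm_drift_le (norm_radialProj_le q)

theorem lipschitzWith_cutoffDrift : LipschitzWith 12 cutoffDrift := by
  refine LipschitzWith.of_dist_le_mul fun p q => ?_
  rw [dist_eq_norm, dist_eq_norm]
  have h := norm_drift_sub_le (norm_radialProj_le p) (norm_radialProj_le q)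
  have h2 := norm_radialProj_sub_le p q
  -- The constant is `(2 + 4 * 1) * 2`: drift on the unit ball, then radial projection.
  show ‖drift _ - drift _‖ ≤ 12 * ‖p - q‖
  linarith

/-- Solutions of the fluid equation are unique. -/
theorem IsFluidSolution.eqOn {q : EllOne} {u v : ℝ → EllOne} (hu : IsFluidSolution q u)
    (hv : IsFluidSolution q v) : EqOn u v (Ici 0) := by
  intro T hT
  have cont : ∀ {w}, IsFluidSolution q w → ContinuousOn w (Icc 0 T) := fun hw t ht =>
    ((hw.deriv t ht.1).continuousWithinAt).mono fun _ hs => hs.1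
  have right : ∀ {w}, IsFluidSolution q w → ∀ t ∈ Ico 0 T,
      HasDerivWithinAt w (drift (w t)) (Ici t) t := fun hw t ht =>
    (hw.deriv t ht.1).mono (Ici_subset_Ici.2 ht.1)
  -- Continuity on a compact interval confines both solutions to one ball, on which the drift is
  -- Lipschitz.
  have bdd : ∀ {w}, IsFluidSolution q w → ∃ C, ∀ t ∈ Icc 0 T, ‖w t‖ ≤ C := fun hw =>
    isCompact_Icc.exists_bound_of_continuousOn (cont hw)
  obtain ⟨C, hC⟩ := bdd hu
  obtain ⟨D, hD⟩ := bdd hv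
  set r := max C D
  have hr : 0 ≤ r := (norm_nonneg _).trans ((hC 0 ⟨le_rfl, hT⟩).trans (le_max_left _ _))
  refine ODE_solution_unique_of_mem_Icc_right (v := fun _ => drift)
    (s := fun _ => Metric.closedBall 0 r) (K := ⟨2 + 4 * r, by positivity⟩) (fun _ _ => ?_)
    (cont hu) (right hu) (fun t ht => ?_) (cont hv) (right hv) (fun t ht => ?_)
    (by rw [hu.init, hv.init]) ⟨hT, le_rfl⟩
  · refine LipschitzOnWith.of_dist_le_mul fun p hp q hq => ?_
    rw [dist_eq_norm, dist_eq_norm]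
    exact norm_drift_sub_le (by simpa using hp) (by simpa using hq)
  · exact mem_closedBall_zero_iff.2 ((hC t ⟨ht.1, ht.2.le⟩).trans (le_max_left _ _))
  · exact mem_closedBall_zero_iff.2 ((hD t ⟨ht.1, ht.2.le⟩).trans (le_max_right _ _))

/-! ### The generator on empirical frequencies -/

section Generator

variable {n m : ℕ}

theorem empirical_apply (x : Config n m) (k : ℕ) :
    empirical x k = (1 / (n : ℝ)) * ∑ i, if x.1 i = k then (1 : ℝ) else 0 := by
  rw [empirical, lp.coeFn_smul, Pi.smul_apply, lp.coeFn_sum, Finset.sum_apply, smul_eq_mul]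
  simp only [lp.single_apply, Pi.single_apply, eq_comm (a := k)]

theorem norm_empirical_le (x : Config n m) : ‖empirical x‖ ≤ 1 := by
  rw [empirical, norm_smul]
  have h : ‖∑ i, lp.single (E := fun _ : ℕ => ℝ) 1 (x.1 i) (1 : ℝ)‖ ≤ n := by
    refine (norm_sum_le _ _).trans ?_
    simp [lp.norm_single]
  have h0 : (0 : ℝ) ≤ 1 / n := by positivity
  rw [Real.norm_of_nonneg h0]
  refine (mul_le_mul_of_nonneg_left h h0).trans ?_
  rw [one_div]
  exact inv_mul_le_one

/-- Markov's inequality for the occupation number of a uniformly chosen site, whose mean is `m / n`.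
-/
theorem mul_norm_shiftLeft_pow_empirical_le (x : Config n m) (K : ℕ) :
    K * ‖(shiftLeft ^ K) (empirical x)‖ ≤ m / n := by
  have h1 : ∀ a : ℕ, K * ‖(shiftLeft ^ K) (lp.single (E := fun _ : ℕ => ℝ) 1 a (1 : ℝ))‖ ≤ a := by
    intro a
    rcases lt_or_ge a K with h | h
    · rw [shiftLeft_pow_single_of_lt h]
      simp
    · have h2 := norm_shiftLeft_pow_le (lp.single (E := fun _ : ℕ => ℝ) 1 a (1 : ℝ)) K
      rw [lp.norm_single (by simp), norm_one] at h2
      have h3 : (K : ℝ) ≤ a := by exact_mod_cast h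
      exact (mul_le_of_le_one_right (Nat.cast_nonneg _) h2).trans h3
  have h0 : (0 : ℝ) ≤ 1 / n := by positivity
  rw [empirical, map_smul, map_sum, norm_smul, Real.norm_of_nonneg h0]
  calc K * (1 / (n : ℝ) * ‖∑ i, (shiftLeft ^ K) (lp.single 1 (x.1 i) (1 : ℝ))‖)
      ≤ K * (1 / (n : ℝ) * ∑ i, ‖(shiftLeft ^ K) (lp.single 1 (x.1 i) (1 : ℝ))‖) := by
        gcongr
        exact norm_sum_le _ _
    _ = 1 / (n : ℝ) * ∑ i, K * ‖(shiftLeft ^ K) (lp.single 1 (x.1 i) (1 : ℝ))‖ := by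
        rw [← Finset.mul_sum]; ring
    _ ≤ 1 / (n : ℝ) * ∑ i, (x.1 i : ℝ) := by
        gcongr with i
        exact h1 _
    _ = m / n := by
        rw [← Nat.cast_sum, x.2]; ring

theorem busy_empirical (x : Config n m) :
    busy (empirical x) = (1 / (n : ℝ)) * ∑ i, if 0 < x.1 i then (1 : ℝ) else 0 := by
  rw [empirical, map_smul, map_sum, smul_eq_mul]
  congr 1
  refine Finset.sum_congr rfl fun i _ => ?_
  rw [busy_apply]
  rcases Nat.eq_zero_or_pos (x.1 i) with h | h
  · simp [lp.single_apply, h]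
  · obtain ⟨a, ha⟩ := Nat.exists_eq_add_of_lt h
    rw [if_pos h, tsum_eq_single a]
    · simp [lp.single_apply, ha]
    · intro b hb
      simp [lp.single_apply, ha, hb]

/-- Only the two sites involved change. The diagonal is separate because there the departure and the
arrival cancel. -/
theorem sum_move_apply (g : ℕ → ℝ) (x : Config n m) {i j : Fin n} (h : 0 < x.1 i) :
    ∑ l, g ((move x i j h).1 l) = ∑ l, g (x.1 l) +
      if i = j then 0 else g (x.1 i - 1) - g (x.1 i) + (g (x.1 j + 1) - g (x.1 j)) := by
  rw [← sub_eq_iff_eq_add', ← Finset.sum_sub_distrib]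
  have hm : ∀ l, (move x i j h).1 l
      = x.1 l + (if l = j then 1 else 0) - (if l = i then 1 else 0) := fun l => by
    simp [move, Pi.single_apply]
  by_cases hij : i = j
  · subst hij
    rw [if_pos rfl]
    refine Finset.sum_eq_zero fun l _ => ?_
    rw [hm]
    by_cases hl : l = i <;> simp [hl]
  · rw [if_neg hij]
    have : ∀ l, g ((move x i j h).1 l) - g (x.1 l)
        = (if l = i then g (x.1 i - 1) - g (x.1 i) else 0)
          + (if l = j then g (x.1 j + 1) - g (x.1 j) else 0) := by
      intro l
      rw [hm]
      by_cases hli : l = i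
      · subst hli
        simp [hij]
      · by_cases hlj : l = j
        · subst hlj
          simp [hli]
        · simp [hli, hlj]
    simp only [this, Finset.sum_add_distrib, Finset.sum_ite_eq', Finset.mem_univ, if_true]

/-- The average over the sites of a function of the occupation number. -/
def siteAverage (g : ℕ → ℝ) (x : Config n m) : ℝ := (1 / (n : ℝ)) * ∑ i, g (x.1 i)

theorem generator_apply (f : Config n m → ℝ) (x : Config n m) : generator n m f x =
    (1 / (n : ℝ)) * ∑ i, ∑ j, if h : 0 < x.1 i then f (move x i j h) - f x else 0 := rfl

theorem siteAverage_move (g : ℕ → ℝ) (x : Config n m) {i j : Fin n} (h : 0 < x.1 i) :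
    siteAverage g (move x i j h) - siteAverage g x = (1 / (n : ℝ)) *
      if i = j then 0 else g (x.1 i - 1) - g (x.1 i) + (g (x.1 j + 1) - g (x.1 j)) := by
  rw [siteAverage, siteAverage, sum_move_apply g x h]
  ring

theorem abs_siteAverage_move_le {g : ℕ → ℝ} (hg : ∀ a b, |g a - g b| ≤ 1) (x : Config n m)
    {i j : Fin n} (h : 0 < x.1 i) :
    |siteAverage g (move x i j h) - siteAverage g x| ≤ 2 / n := by
  rw [siteAverage_move, abs_mul, abs_of_nonneg (by positivity : (0 : ℝ) ≤ 1 / n), one_div,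
    div_eq_inv_mul]
  gcongr
  split_ifs
  · simp
  · exact (abs_add_le _ _).trans (by linarith [hg (x.1 i - 1) (x.1 i), hg (x.1 j + 1) (x.1 j)])

/-- The carré du champ of an average of a function with oscillation at most one. -/
theorem carre_du_champ_siteAverage_le {g : ℕ → ℝ} (hg : ∀ a b, |g a - g b| ≤ 1)
    (x : Config n m) :
    generator n m (siteAverage g ^ 2) x - 2 * siteAverage g x * generator n m (siteAverage g) x
      ≤ 4 / n := by
  -- For each jump, `b² - a² - 2a(b - a) = (b - a)²`.
  have e : generator n m (siteAverage g ^ 2) x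
      - 2 * siteAverage g x * generator n m (siteAverage g) x
      = (1 / (n : ℝ)) * ∑ i, ∑ j, if h : 0 < x.1 i then
        (siteAverage g (move x i j h) - siteAverage g x) ^ 2 else 0 := by
    rw [generator_apply, generator_apply, mul_left_comm, ← mul_sub]
    congr 1
    simp only [Finset.mul_sum, ← Finset.sum_sub_distrib]
    refine Finset.sum_congr rfl fun i _ => Finset.sum_congr rfl fun j _ => ?_
    split_ifs
    · simp only [Pi.pow_apply]; ring
    · simp
  rw [e]
  have h1 : ∀ i j : Fin n, (if h : 0 < x.1 i then
      (siteAverage g (move x i j h) - siteAverage g x) ^ 2 else 0) ≤ (2 / (n : ℝ)) ^ 2 := by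
    intro i j
    split_ifs with h
    · exact sq_le_sq' (by linarith [neg_abs_le (siteAverage g (move x i j h) - siteAverage g x),
        abs_siteAverage_move_le hg x (j := j) h])
        ((le_abs_self _).trans (abs_siteAverage_move_le hg x h))
    · positivity
  have h2 : (∑ i : Fin n, ∑ j : Fin n, if h : 0 < x.1 i then
      (siteAverage g (move x i j h) - siteAverage g x) ^ 2 else 0) ≤
      ∑ _i : Fin n, ∑ _j : Fin n, (2 / (n : ℝ)) ^ 2 :=
    Finset.sum_le_sum fun i _ => Finset.sum_le_sum fun j _ => h1 i j
  refine (mul_le_mul_of_nonneg_left h2 (by positivity)).trans (le_of_eq ?_)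
  rcases Nat.eq_zero_or_pos n with hn | hn
  · subst hn; simp
  · have : (n : ℝ) ≠ 0 := by positivity
    simp only [Finset.sum_const, Finset.card_univ, Fintype.card_fin, nsmul_eq_mul]
    field_simp
    norm_num

theorem empirical_eq_siteAverage (x : Config n m) (k : ℕ) :
    empirical x k = siteAverage (fun a => if a = k then 1 else 0) x := empirical_apply x k

/-- The generator acts on empirical frequencies as the drift, up to an error of order `1 / n`. -/
theorem abs_generator_empirical_sub_drift_le (x : Config n m) (k : ℕ) :
    |generator n m (fun y => empirical y k) x - drift (empirical x) k| ≤ 2 / n := by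
  rcases Nat.eq_zero_or_pos n with hn | hn
  · subst hn
    have : empirical x = 0 := by simp [empirical]
    rw [this, drift_zero]
    simp [generator_apply]
  have hn' : (n : ℝ) ≠ 0 := by positivity
  set g : ℕ → ℝ := fun a => if a = k then 1 else 0 with hg
  have hosc : ∀ a b, |g a - g b| ≤ 1 := by
    intro a b
    simp only [hg]
    split_ifs <;> simp
  set a : Fin n → ℝ := fun i => g (x.1 i - 1) - g (x.1 i) with ha
  set b : Fin n → ℝ := fun i => g (x.1 i + 1) - g (x.1 i) with hb
  set p : Fin n → ℝ := fun i => if 0 < x.1 i then 1 else 0 with hp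
  -- Over all ordered pairs the rates factorise and give exactly the drift. A move with `i = j` does
  -- nothing, so the diagonal is subtracted; it has `n` terms of size at most `2`, against the
  -- prefactor `1 / n ^ 2`.
  have hgen : generator n m (fun y => empirical y k) x = (1 / (n : ℝ)) ^ 2 *
      (n * (∑ i, p i * a i) + (∑ i, p i) * (∑ j, b j) - ∑ i, p i * (a i + b i)) := by
    have h1 : ∀ i j : Fin n, (if h : 0 < x.1 i then
        empirical (move x i j h) k - empirical x k else 0) = (1 / (n : ℝ)) *
          (p i * a i + p i * b j - if i = j then p i * (a i + b i) else 0) := by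
      intro i j
      split_ifs with h hij hij
      · rw [empirical_eq_siteAverage, empirical_eq_siteAverage, siteAverage_move, if_pos hij]
        subst hij
        ring
      · rw [empirical_eq_siteAverage, empirical_eq_siteAverage, siteAverage_move, if_neg hij]
        simp [hp, h, ha, hb, hg]
      · subst hij
        simp [hp, h]
      · simp [hp, h]
    rw [generator_apply]
    simp only [h1, ← Finset.mul_sum, Finset.sum_sub_distrib, Finset.sum_add_distrib,
      Finset.sum_ite_eq, Finset.mem_univ, if_true, Finset.sum_const, Finset.card_univ,
      Fintype.card_fin, nsmul_eq_mul, ← Finset.sum_mul]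
    simp only [mul_left_comm _ (n : ℝ), ← Finset.mul_sum]
    ring
  have hdrift : drift (empirical x) k = (1 / (n : ℝ)) ^ 2 *
      (n * (∑ i, p i * a i) + (∑ i, p i) * (∑ j, b j)) := by
    have hA : (shiftLeft (empirical x) - shiftRight (shiftLeft (empirical x))) k
        = (1 / (n : ℝ)) * ∑ i, p i * a i := by
      simp only [lp.coeFn_sub, Pi.sub_apply, shiftRight_apply, shiftLeft_apply, empirical_apply]
      rw [show (if 1 ≤ k then 1 / (n : ℝ) * ∑ i, (if x.1 i = k - 1 + 1 then (1 : ℝ) else 0) else 0)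
        = 1 / (n : ℝ) * ∑ i, (if 1 ≤ k ∧ x.1 i = k then (1 : ℝ) else 0) by
          by_cases hk : 1 ≤ k
          · simp [hk, Nat.sub_add_cancel hk]
          · simp [hk], ← mul_sub, ← Finset.sum_sub_distrib]
      congr 1
      refine Finset.sum_congr rfl fun i _ => ?_
      simp only [hp, ha, hg]
      generalize x.1 i = c
      rcases c with _ | c
      · rcases k with _ | k <;> simp
      · rcases k with _ | k <;> simp
    have hB : ((empirical x) - shiftRight (empirical x)) k
        = -((1 / (n : ℝ)) * ∑ i, b i) := by
      simp only [lp.coeFn_sub, Pi.sub_apply, shiftRight_apply, empirical_apply]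
      rw [show (if 1 ≤ k then 1 / (n : ℝ) * ∑ i, (if x.1 i = k - 1 then (1 : ℝ) else 0) else 0)
        = 1 / (n : ℝ) * ∑ i, (if x.1 i + 1 = k then (1 : ℝ) else 0) by
          rcases k with _ | k <;> simp, ← mul_sub, ← Finset.sum_sub_distrib, ← mul_neg,
          ← Finset.sum_neg_distrib]
      congr 1
      refine Finset.sum_congr rfl fun i _ => ?_
      simp only [hb, hg]
      ring
    rw [drift_eq, lp.coeFn_sub, Pi.sub_apply, hA, lp.coeFn_smul, Pi.smul_apply, hB, busy_empirical,
      smul_eq_mul]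
    field_simp
    ring
  have hpab : |∑ i, p i * (a i + b i)| ≤ n * 2 := by
    refine (Finset.abs_sum_le_sum_abs _ _).trans ?_
    have : ∀ i ∈ Finset.univ, |p i * (a i + b i)| ≤ 2 := by
      intro i _
      have h1 : |p i| ≤ 1 := by simp only [hp]; split_ifs <;> simp
      have h2 : |a i + b i| ≤ 2 :=
        (abs_add_le _ _).trans (by linarith [hosc (x.1 i - 1) (x.1 i), hosc (x.1 i + 1) (x.1 i)])
      rw [abs_mul]
      calc |p i| * |a i + b i| ≤ 1 * 2 := by gcongr
        _ = 2 := one_mul _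
    simpa using Finset.sum_le_card_nsmul _ _ _ this
  rw [hgen, hdrift, ← mul_sub, sub_sub_cancel_left, abs_mul, abs_neg,
    abs_of_nonneg (by positivity)]
  refine (mul_le_mul_of_nonneg_left hpab (by positivity)).trans (le_of_eq ?_)
  field_simp

end Generator

/-! ### Kolmogorov's inequality -/

/-- **Kolmogorov's maximal inequality** for sums of bounded martingale increments. -/
theorem measure_max_sum_increments_le {Ω : Type*} {m0 : MeasurableSpace Ω} {P : Measure Ω}
    [IsProbabilityMeasure P] (ℱ : Filtration ℕ m0) {ξ : ℕ → Ω → ℝ}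
    (hmeas : ∀ j, StronglyMeasurable[ℱ (j + 1)] (ξ j)) {B : ℝ} (hB : ∀ j ω, |ξ j ω| ≤ B)
    (hmart : ∀ j, P[ξ j | ℱ j] =ᵐ[P] 0) {v : ℝ} (hv : ∀ j, ∫ ω, ξ j ω ^ 2 ∂P ≤ v) (N : ℕ)
    {ε : ℝ} (hε : 0 < ε) :
    P {ω | ∃ i ≤ N, ε ≤ |∑ j ∈ Finset.range i, ξ j ω|} ≤ ENNReal.ofReal (N * v / ε ^ 2) := by
  set D : ℕ → Ω → ℝ := fun i ω => ∑ j ∈ Finset.range i, ξ j ω with hD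
  have hDmeas : ∀ i, StronglyMeasurable[ℱ i] (D i) := fun i =>
    Finset.stronglyMeasurable_fun_sum _ fun j hj =>
      (hmeas j).mono (ℱ.mono (Finset.mem_range.1 hj))
  have hDbd : ∀ i ω, |D i ω| ≤ i * B := fun i ω => by
    refine (Finset.abs_sum_le_sum_abs _ _).trans ?_
    simpa using Finset.sum_le_card_nsmul (Finset.range i) _ _ fun j _ => hB j ω
  have bdInt : ∀ {g : Ω → ℝ} (C : ℝ), StronglyMeasurable g → (∀ ω, |g ω| ≤ C) → Integrable g P :=
    fun C hg hC => Integrable.of_bound hg.aestronglyMeasurable C (ae_of_all _ hC)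
  have hξm : ∀ j, StronglyMeasurable (ξ j) := fun j => (hmeas j).mono (ℱ.le _)
  have hDm : ∀ j, StronglyMeasurable (D j) := fun j => (hDmeas j).mono (ℱ.le _)
  have hξint : ∀ j, Integrable (ξ j) P := fun j => bdInt B (hξm j) (hB j)
  have hξ2int : ∀ j, Integrable (fun ω => ξ j ω ^ 2) P := fun j =>
    bdInt (B ^ 2) ((hξm j).pow 2) fun ω => by
      rw [abs_pow]; exact pow_le_pow_left₀ (abs_nonneg _) (hB j ω) 2
  have hD2int : ∀ j, Integrable (fun ω => D j ω ^ 2) P := fun j =>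
    bdInt ((j * B) ^ 2) ((hDm j).pow 2) fun ω => by
      rw [abs_pow]; exact pow_le_pow_left₀ (abs_nonneg _) (hDbd j ω) 2
  have hDξint : ∀ j, Integrable (D j * ξ j) P := fun j =>
    bdInt (j * B * B) ((hDm j).mul (hξm j)) fun ω => by
      rw [Pi.mul_apply, abs_mul]
      exact mul_le_mul (hDbd j ω) (hB j ω) (abs_nonneg _) ((abs_nonneg _).trans (hDbd j ω))
  -- The partial sum is known before its next increment, so the two are orthogonal: variances add,
  -- and the squares form a submartingale.
  have hcross : ∀ j, P[D j * ξ j | ℱ j] =ᵐ[P] 0 := fun j => by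
    refine (condExp_mul_of_stronglyMeasurable_left (hDmeas j) (hDξint j) (hξint j)).trans ?_
    filter_upwards [hmart j] with ω hω
    simp [hω]
  have hsucc : ∀ j, (fun ω => D (j + 1) ω ^ 2) - (fun ω => D j ω ^ 2)
      = (2 : ℝ) • (D j * ξ j) + fun ω => ξ j ω ^ 2 := fun j => by
    funext ω
    simp only [Pi.sub_apply, Pi.add_apply, Pi.smul_apply, Pi.mul_apply, smul_eq_mul, hD,
      Finset.sum_range_succ]
    ring
  have hsub : Submartingale (fun i ω => D i ω ^ 2) ℱ P := by
    refine submartingale_of_condExp_sub_nonneg_nat (fun i => (hDmeas i).pow 2) hD2int fun i => ?_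
    rw [hsucc]
    have h1 := condExp_add (((hDξint i).smul (2 : ℝ))) (hξ2int i) (ℱ i)
    have h2 := condExp_smul (μ := P) (2 : ℝ) (D i * ξ i) (ℱ i)
    have h3 : 0 ≤ᵐ[P] P[fun ω => ξ i ω ^ 2 | ℱ i] :=
      condExp_nonneg (ae_of_all _ fun ω => sq_nonneg _)
    filter_upwards [h1, h2, h3, hcross i] with ω e1 e2 e3 e4
    rw [e1, Pi.add_apply, e2, Pi.smul_apply, e4]
    simpa using e3
  have hvar : ∀ i : ℕ, ∫ ω, D i ω ^ 2 ∂P ≤ i * v := by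
    intro i
    induction i with
    | zero => simp [hD]
    | succ i ih =>
      have h0 : ∫ ω, (D i * ξ i) ω ∂P = 0 := by
        rw [← integral_condExp (ℱ.le i), integral_congr_ae (hcross i)]
        simp
      have h1 : ∫ ω, D (i + 1) ω ^ 2 ∂P - ∫ ω, D i ω ^ 2 ∂P = ∫ ω, ξ i ω ^ 2 ∂P := by
        rw [← integral_sub (hD2int _) (hD2int _)]
        have : ∀ ω, D (i + 1) ω ^ 2 - D i ω ^ 2 = 2 * (D i * ξ i) ω + ξ i ω ^ 2 := fun ω =>
          congrFun (hsucc i) ω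
        simp only [this]
        rw [integral_add ((hDξint i).const_mul 2) (hξ2int i), integral_const_mul, h0]
        simp
      push_cast
      linarith [hv i]
  have hmax := maximal_ineq hsub (fun i ω => sq_nonneg _) (ε := (ε ^ 2).toNNReal) N
  set A : Set Ω := {ω | ((ε ^ 2).toNNReal : ℝ) ≤
    (Finset.range (N + 1)).sup' Finset.nonempty_range_add_one fun k => D k ω ^ 2} with hA
  have hAeq : {ω | ∃ i ≤ N, ε ≤ |∑ j ∈ Finset.range i, ξ j ω|} ⊆ A := by
    rintro ω ⟨i, hi, h⟩
    simp only [hA, mem_ofPred_eq, Finset.le_sup'_iff, Real.coe_toNNReal _ (sq_nonneg ε)]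
    refine ⟨i, Finset.mem_range.2 (Nat.lt_succ_of_le hi), ?_⟩
    show ε ^ 2 ≤ D i ω ^ 2
    rw [← sq_abs (D i ω)]
    exact pow_le_pow_left₀ hε.le h 2
  have hle : ∫ ω in A, D N ω ^ 2 ∂P ≤ N * v :=
    (setIntegral_le_integral (hD2int N) (ae_of_all _ fun ω => sq_nonneg _)).trans (hvar N)
  rw [ENNReal.ofReal_div_of_pos (by positivity), ENNReal.le_div_iff_mul_le
    (Or.inl (by simpa using hε.ne')) (Or.inl ENNReal.ofReal_ne_top), mul_comm]
  exact (mul_le_mul_right (measure_mono hAeq) _).trans (hmax.trans (ENNReal.ofReal_le_ofReal hle))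

/-! ### The skeleton chain and its Dynkin martingale -/

section Skeleton

variable {Ω : Type*} [mΩ : MeasurableSpace Ω] {n m : ℕ} {P : Measure Ω} [IsProbabilityMeasure P]
  {η : ℝ≥0 → Ω → Config n m}

/-- The filtration generated by a process, observed along the multiples of `h`. -/
def skeletonFiltration (hη : ∀ t, Measurable (η t)) (h : ℝ≥0) :
    Filtration ℕ mΩ where
  seq i := history η (i * h)
  mono' i j hij := by
    have : (i : ℝ≥0) * h ≤ j * h := by gcongr
    exact iSup₂_le fun u hu => le_iSup₂_of_le u (hu.trans this) le_rfl
  le' i := iSup₂_le fun u _ => (hη u).comap_le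

theorem measurable_history {Ω S : Type*} [MeasurableSpace S] {η : ℝ≥0 → Ω → S} {s u : ℝ≥0} (hu : u ≤ s) : Measurable[history η s] (η u) := by
  rw [measurable_iff_comap_le]
  exact le_iSup₂_of_le u hu le_rfl

/-- The conditional variance of `f (η (s + h))` given `η s = x`. -/
def stepVariance (n m : ℕ) (h : ℝ) (f : Config n m → ℝ) (x : Config n m) : ℝ :=
  semigroup n m h (f ^ 2) x - semigroup n m h f x ^ 2

/-- Maximal inequality for the discrete-time Dynkin martingale of a zero-range process. -/
theorem IsZeroRangeProcess.measure_max_dynkin_le (hη : IsZeroRangeProcess n m P η)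
    (f : Config n m → ℝ) (h : ℝ≥0) {v : ℝ} (hv : ∀ x, stepVariance n m h f x ≤ v) (N : ℕ)
    {ε : ℝ} (hε : 0 < ε) :
    P {ω | ∃ i ≤ N, ε ≤ |∑ j ∈ Finset.range i,
      (f (η ((j + 1 : ℕ) * h) ω) - semigroup n m h f (η (j * h) ω))|} ≤
      ENNReal.ofReal (N * v / ε ^ 2) := by
  set g : Config n m → ℝ := semigroup n m h f with hg
  obtain ⟨B, hB⟩ : ∃ B, ∀ x y, |f x - g y| ≤ B := by
    obtain ⟨B, hB⟩ := (Set.finite_range fun p : Config n m × Config n m =>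
      |f p.1 - g p.2|).bddAbove
    exact ⟨B, fun x y => hB ⟨(x, y), rfl⟩⟩
  -- Stated for a pair of times; where only one matters, the other is set to `0` below.
  have hint : ∀ F : Config n m × Config n m → ℝ, ∀ s t,
      Integrable (fun ω => F (η s ω, η t ω)) P := fun F s t => by
    obtain ⟨C, hC⟩ := (Set.finite_range fun p => |F p|).bddAbove
    exact Integrable.of_bound
      ((measurable_of_countable F).comp ((hη.measurable s).prodMk
        (hη.measurable t))).aestronglyMeasurable C (ae_of_all _ fun ω => hC ⟨_, rfl⟩)
  have hsm : ∀ (F : Config n m → ℝ) {s u : ℝ≥0}, u ≤ s →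
      StronglyMeasurable[history η s] (fun ω => F (η u ω)) := fun F s u hu =>
    ((measurable_of_countable F).comp (measurable_history hu)).stronglyMeasurable
  have hle : ∀ s, history η s ≤ mΩ := fun s =>
    iSup₂_le fun u _ => (hη.measurable u).comap_le
  have hstep : ∀ j : ℕ, ((j + 1 : ℕ) : ℝ≥0) * h = j * h + h := fun j => by push_cast; ring
  refine measure_max_sum_increments_le (skeletonFiltration hη.measurable h) (B := B)
    (ξ := fun j ω => f (η ((j + 1 : ℕ) * h) ω) - g (η (j * h) ω)) (fun j => ?_)
    (fun j ω => hB _ _) (fun j => ?_) (fun j => ?_) N hε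
  · exact (hsm f le_rfl).sub (hsm g (by gcongr; simp))
  · rw [hstep]
    have h1 := condExp_sub (m := history η (j * h)) (hint (fun p => f p.1) (j * h + h) 0)
      (hint (fun p => g p.1) (j * h) 0)
    have h2 := condExp_of_stronglyMeasurable (hle (j * h)) (hsm g le_rfl)
      (hint (fun p => g p.1) (j * h) 0)
    filter_upwards [h1, hη.markov f (j * h) h] with ω e1 e2
    refine e1.trans ?_
    rw [Pi.sub_apply, h2, e2]
    simp [hg]
  · rw [hstep]
    have e : ∀ ω, (f (η (j * h + h) ω) - g (η (j * h) ω)) ^ 2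
        = (f ^ 2) (η (j * h + h) ω) - 2 * (g (η (j * h) ω) * f (η (j * h + h) ω))
          + g (η (j * h) ω) ^ 2 := fun ω => by simp only [Pi.pow_apply]; ring
    have h1 : ∫ ω, (f ^ 2) (η (j * h + h) ω) ∂P
        = ∫ ω, semigroup n m h (f ^ 2) (η (j * h) ω) ∂P := by
      rw [← integral_condExp (hle (j * h))]
      exact integral_congr_ae (hη.markov (f ^ 2) (j * h) h)
    -- Conditioning on the past replaces `f` at the later time by `g` at the earlier one.
    have h2 : ∫ ω, g (η (j * h) ω) * f (η (j * h + h) ω) ∂P = ∫ ω, g (η (j * h) ω) ^ 2 ∂P := by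
      rw [← integral_condExp (hle (j * h))]
      refine integral_congr_ae ?_
      refine (condExp_mul_of_stronglyMeasurable_left (hsm g le_rfl)
        (hint (fun p => g p.1 * f p.2) (j * h) (j * h + h))
        (hint (fun p => f p.1) (j * h + h) 0)).trans ?_
      filter_upwards [hη.markov f (j * h) h] with ω e2
      rw [Pi.mul_apply, e2, sq]
    have hi1 : Integrable (fun ω => (f ^ 2) (η (j * h + h) ω)) P :=
      hint (fun p => (f ^ 2) p.1) (j * h + h) 0
    have hi2 : Integrable (fun ω => 2 * (g (η (j * h) ω) * f (η (j * h + h) ω))) P :=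
      (hint (fun p => g p.1 * f p.2) (j * h) (j * h + h)).const_mul 2
    have hi3 : Integrable (fun ω => g (η (j * h) ω) ^ 2) P :=
      hint (fun p => g p.1 ^ 2) (j * h) 0
    have hi4 : Integrable (fun ω => semigroup n m h (f ^ 2) (η (j * h) ω)) P :=
      hint (fun p => semigroup n m h (f ^ 2) p.1) (j * h) 0
    have hi5 : Integrable (fun ω => (f ^ 2) (η (j * h + h) ω)
        - 2 * (g (η (j * h) ω) * f (η (j * h + h) ω))) P := hi1.sub hi2
    simp only [e]
    rw [integral_add hi5 hi3, integral_sub hi1 hi2, integral_const_mul, h1, h2]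
    have h5 : ∫ ω, stepVariance n m h f (η (j * h) ω) ∂P ≤ v := by
      calc _ ≤ ∫ _ω, v ∂P := integral_mono
            (hint (fun p => stepVariance n m h f p.1) (j * h) 0) (integrable_const _)
            fun ω => hv _
        _ = v := by simp
    have h6 : ∫ ω, stepVariance n m h f (η (j * h) ω) ∂P
        = ∫ ω, semigroup n m h (f ^ 2) (η (j * h) ω) ∂P - ∫ ω, g (η (j * h) ω) ^ 2 ∂P := by
      rw [← integral_sub hi4 hi3]
      rfl
    linarith

end Skeleton

/-! ### Small-time asymptotics of the semigroup -/

section Asymptotics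

variable {n m : ℕ}

theorem semigroup_zero (f : Config n m → ℝ) : semigroup n m 0 f = f := by
  simp [semigroup]

theorem hasDerivAt_semigroup_apply (f : Config n m → ℝ) (x : Config n m) :
    HasDerivAt (fun t : ℝ => semigroup n m t f x) (generator n m f x) 0 := by
  have h := hasDerivAt_exp_smul_const (𝕂 := ℝ) (generator n m) 0
  have h1 := h.clm_apply (hasDerivAt_const (0 : ℝ) f)
  have h2 := hasDerivAt_pi.1 h1 x
  simp only [zero_smul, NormedSpace.exp_zero, one_mul, map_zero, add_zero] at h2
  exact h2

/-- This is the difference quotient of `s ↦ φ (T * s)` along `s = 1 / N`; rescaling the argument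
also covers `T = 0`. -/
theorem tendsto_mul_of_hasDerivAt {φ : ℝ → ℝ} {φ' T : ℝ} (hφ : HasDerivAt φ φ' 0) (h0 : φ 0 = 0) :
    Tendsto (fun N : ℕ => (N : ℝ) * φ (T / N)) atTop (𝓝 (T * φ')) := by
  have hc : HasDerivAt (fun s => φ (T * s)) (φ' * T) 0 := by
    have h1 : HasDerivAt (fun s : ℝ => T * s) T 0 := by
      simpa using (hasDerivAt_id (0 : ℝ)).const_mul T
    have h2 : HasDerivAt φ φ' (T * 0) := by simpa using hφ
    exact h2.comp (0 : ℝ) h1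
  have h2 := hasDerivAt_iff_tendsto_slope_zero.1 hc
  have h3 : Tendsto (fun N : ℕ => ((N : ℝ))⁻¹) atTop (𝓝[≠] 0) :=
    tendsto_nhdsWithin_iff.2 ⟨tendsto_inv_atTop_nhds_zero_nat, by
      filter_upwards [eventually_gt_atTop 0] with N hN
      simpa using hN.ne'⟩
  have h4 := h2.comp h3
  rw [mul_comm]
  refine h4.congr fun N => ?_
  simp [h0, div_eq_mul_inv]

/-- The one-step increments of the semigroup approximate the generator, uniformly. -/
theorem eventually_semigroup_sub_le (T : ℝ) (f : Config n m → ℝ) {δ : ℝ} (hδ : 0 < δ) :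
    ∀ᶠ N : ℕ in atTop, ∀ x,
      |N * (semigroup n m (T / N) f x - f x) - T * generator n m f x| ≤ δ := by
  refine eventually_all.2 fun x => ?_
  have h := tendsto_mul_of_hasDerivAt (T := T) ((hasDerivAt_semigroup_apply f x).sub_const (f x))
    (by simp [semigroup_zero])
  filter_upwards [Metric.tendsto_nhds.1 h δ hδ] with N hN
  exact hN.le

/-- The derivative at time zero of the one-step variance is the carré du champ. Uniformity in `x`
comes from the finiteness of the state space. -/
theorem eventually_stepVariance_le (T : ℝ) (f : Config n m → ℝ) {δ : ℝ} (hδ : 0 < δ) :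
    ∀ᶠ N : ℕ in atTop, ∀ x, N * stepVariance n m (T / N) f x ≤
      T * (generator n m (f ^ 2) x - 2 * f x * generator n m f x) + δ := by
  refine eventually_all.2 fun x => ?_
  have h1 : HasDerivAt (fun t => stepVariance n m t f x)
      (generator n m (f ^ 2) x - 2 * f x * generator n m f x) 0 := by
    have := (hasDerivAt_semigroup_apply (f ^ 2) x).sub ((hasDerivAt_semigroup_apply f x).pow 2)
    simp only [semigroup_zero, Nat.cast_ofNat, Nat.add_one_sub_one, pow_one] at this
    exact this
  have h := tendsto_mul_of_hasDerivAt (T := T) h1 (by simp [stepVariance, semigroup_zero])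
  filter_upwards [Metric.tendsto_nhds.1 h δ hδ] with N hN
  rw [Real.dist_eq] at hN
  linarith [le_abs_self (N * stepVariance n m (T / N) f x -
    T * (generator n m (f ^ 2) x - 2 * f x * generator n m f x))]

end Asymptotics

/-! ### Comparison with the fluid equation for a fixed process -/

section Fixed

variable {n m : ℕ}

theorem norm_shiftLeft_pow_empirical_le (x : Config n m) {K : ℕ} (hK : 0 < K) :
    ‖(shiftLeft ^ K) (empirical x)‖ ≤ m / n / K := by
  rw [le_div_iff₀' (by exact_mod_cast hK)]
  exact mul_norm_shiftLeft_pow_empirical_le x K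

/-- If the Dynkin martingales of the first frequencies are small along a trajectory of the skeleton
chain, then its empirical distributions nearly follow the Euler scheme of the fluid equation. -/
theorem norm_empirical_sub_euler_le (X : ℕ → Config n m) {N K : ℕ} (hN : 0 < N) (hK : 0 < K)
    {T ε δ : ℝ} (hT : 0 ≤ T)
    (hmart : ∀ k < K + 1, ∀ i ≤ N, |∑ j ∈ Finset.range i,
      (empirical (X (j + 1)) k - semigroup n m (T / N) (fun y => empirical y k) (X j))| ≤ ε)
    (hsg : ∀ k < K + 1, ∀ x : Config n m,
      |N * (semigroup n m (T / N) (fun y => empirical y k) x - empirical x k)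
        - T * generator n m (fun y => empirical y k) x| ≤ δ) {i : ℕ} (hi : i ≤ N) :
    ‖empirical (X i) - empirical (X 0) -
      ∑ j ∈ Finset.range i, (T / N) • cutoffDrift (empirical (X j))‖ ≤
      (K + 1) * (ε + (δ + T * (2 / n))) + (2 + 4 * T) * (m / n / K) := by
  have hN' : (0 : ℝ) < N := by exact_mod_cast hN
  have hiN : (i : ℝ) * (1 / N) ≤ 1 := by
    rw [mul_one_div, div_le_one hN']
    exact_mod_cast hi
  have hδ : 0 ≤ δ := (abs_nonneg _).trans (hsg 0 (Nat.succ_pos _) (X 0))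
  have hcut : ∀ j, cutoffDrift (empirical (X j)) = drift (empirical (X j)) := fun j =>
    cutoffDrift_of_norm_le (norm_empirical_le _)
  simp only [hcut]
  set R := empirical (X i) - empirical (X 0) -
    ∑ j ∈ Finset.range i, (T / N) • drift (empirical (X j)) with hR
  have hcoord : ∀ k < K + 1, |R k| ≤ ε + (δ + T * (2 / n)) := by
    intro k hk
    set f : Config n m → ℝ := fun y => empirical y k with hf
    -- Martingale part plus compensator error; the latter is `O(1 / N)` per step over at most `N`
    -- steps.
    have e : R k = ∑ j ∈ Finset.range i, (f (X (j + 1)) - semigroup n m (T / N) f (X j))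
        + ∑ j ∈ Finset.range i, (semigroup n m (T / N) f (X j) - f (X j)
          - T / N * drift (empirical (X j)) k) := by
      have h1 : R k = f (X i) - f (X 0) -
          ∑ j ∈ Finset.range i, T / N * drift (empirical (X j)) k := by
        rw [hR, lp.coeFn_sub, Pi.sub_apply, lp.coeFn_sub, Pi.sub_apply, lp.coeFn_sum,
          Finset.sum_apply]
        rfl
      rw [h1, ← Finset.sum_range_sub (fun j => f (X j)), ← Finset.sum_sub_distrib,
        ← Finset.sum_add_distrib]
      exact Finset.sum_congr rfl fun j _ => by ring
    have hstep : ∀ j ∈ Finset.range i, |semigroup n m (T / N) f (X j) - f (X j)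
        - T / N * drift (empirical (X j)) k| ≤ 1 / N * (δ + T * (2 / n)) := by
      intro j _
      have e2 : semigroup n m (T / N) f (X j) - f (X j) - T / N * drift (empirical (X j)) k
          = 1 / N * ((N * (semigroup n m (T / N) f (X j) - f (X j)) - T * generator n m f (X j))
            + T * (generator n m f (X j) - drift (empirical (X j)) k)) := by
        field_simp
        ring
      rw [e2, abs_mul, abs_of_nonneg (by positivity : (0 : ℝ) ≤ 1 / N)]
      gcongr
      refine (abs_add_le _ _).trans (add_le_add (hsg k hk _) ?_)
      rw [abs_mul, abs_of_nonneg hT]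
      gcongr
      exact abs_generator_empirical_sub_drift_le _ _
    rw [e]
    refine (abs_add_le _ _).trans (add_le_add (hmart k hk i hi) ?_)
    refine (Finset.abs_sum_le_sum_abs _ _).trans ((Finset.sum_le_sum hstep).trans ?_)
    rw [Finset.sum_const, Finset.card_range, nsmul_eq_mul, ← mul_assoc]
    exact mul_le_of_le_one_left (by positivity) hiN
  -- The two end configurations account for `2`, the accumulated drift for `4 * T`.
  have htail : ‖(shiftLeft ^ (K + 1)) R‖ ≤ (2 + 4 * T) * (m / n / K) := by
    have hQ : ∀ x : Config n m, ‖(shiftLeft ^ (K + 1)) (empirical x)‖ ≤ m / n / K := fun x =>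
      (norm_shiftLeft_pow_succ_le _ _).trans (norm_shiftLeft_pow_empirical_le x hK)
    have hF : ∀ j ∈ Finset.range i, ‖(shiftLeft ^ (K + 1)) ((T / N) • drift (empirical (X j)))‖ ≤
        1 / N * (T * (4 * (m / n / K))) := by
      intro j _
      rw [map_smul, norm_smul, Real.norm_of_nonneg (by positivity), div_eq_mul_one_div T,
        mul_comm T, mul_assoc]
      gcongr
      refine (norm_shiftLeft_pow_drift_le (norm_empirical_le _) K).trans ?_
      gcongr
      exact norm_shiftLeft_pow_empirical_le _ hK
    have hsum : ‖∑ j ∈ Finset.range i, (shiftLeft ^ (K + 1)) ((T / N) • drift (empirical (X j)))‖ ≤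
        T * (4 * (m / n / K)) := by
      refine (norm_sum_le_of_le _ hF).trans ?_
      rw [Finset.sum_const, Finset.card_range, nsmul_eq_mul, ← mul_assoc]
      exact mul_le_of_le_one_left (by positivity) hiN
    rw [hR, map_sub, map_sub, map_sum]
    refine (norm_sub_le _ _).trans ((add_le_add (norm_sub_le _ _) hsum).trans ?_)
    linarith [hQ (X i), hQ (X 0)]
  rw [norm_eq_sum_add_norm_shift R (K + 1)]
  refine add_le_add ?_ htail
  refine (Finset.sum_le_sum fun k hk => hcoord k (Finset.mem_range.1 hk)).trans (le_of_eq ?_)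
  rw [Finset.sum_const, Finset.card_range, nsmul_eq_mul]
  push_cast
  ring

/-- A bound on the distance between the empirical process and the fluid limit up to time `T`, when
the initial distance is `ε₀`, the first `K + 1` martingales are at most `ε`, and `δ` bounds
discretisation errors. -/
def fluidError (n m : ℕ) (T : ℝ) (K : ℕ) (ε₀ ε δ : ℝ) : ℝ :=
  (ε₀ + ((K + 1) * (ε + (δ + T * (2 / n))) + (2 + 4 * T) * (m / n / K)) + δ) * Real.exp (12 * T)

variable {Ω : Type*} [MeasurableSpace Ω] {P : Measure Ω} [IsProbabilityMeasure P]
  {η : ℝ≥0 → Ω → Config n m} {q : EllOne} {u : ℝ → EllOne}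

/-- The bound does not depend on the mesh, so the grid can be refined with the process fixed.
Outside the bad events, for the initial condition and for `K + 1` martingales, the comparison is
deterministic. -/
theorem IsZeroRangeProcess.eventually_measure_grid_le (hη : IsZeroRangeProcess n m P η)
    (hu0 : u 0 = q) (hu : ∀ t, 0 ≤ t → HasDerivWithinAt u (cutoffDrift (u t)) (Ici 0) t)
    (T : ℝ≥0) {K : ℕ} (hK : 0 < K) {ε₀ ε δ : ℝ} (hε₀ : 0 < ε₀) (hε : 0 < ε) (hδ : 0 < δ) :
    ∀ᶠ N : ℕ in atTop,
      P {ω | ∃ i ≤ N, fluidError n m T K ε₀ ε δ <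
        ‖empirical (η (i * (T / N)) ω) - u ((i * (T / N) : ℝ≥0) : ℝ)‖} ≤
      P {ω | ENNReal.ofReal ε₀ ≤ ‖empirical (η 0 ω) - q‖ₑ}
        + (K + 1) * ENNReal.ofReal ((T * (4 / n) + δ) / ε ^ 2) := by
  have hsg : ∀ᶠ N : ℕ in atTop, ∀ k ∈ Finset.range (K + 1), ∀ x : Config n m,
      |N * (semigroup n m (T / N) (fun y => empirical y k) x - empirical x k)
        - T * generator n m (fun y => empirical y k) x| ≤ δ :=
    (Finset.eventually_all _).2 fun k _ =>
      eventually_semigroup_sub_le (T : ℝ) (fun y : Config n m => empirical y k) hδ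
  have hvar : ∀ᶠ N : ℕ in atTop, ∀ k ∈ Finset.range (K + 1), ∀ x : Config n m,
      N * stepVariance n m (T / N) (fun y => empirical y k) x ≤ T * (4 / n) + δ := by
    refine (Finset.eventually_all _).2 fun k _ => ?_
    filter_upwards [eventually_stepVariance_le (T : ℝ) (fun y : Config n m => empirical y k) hδ]
      with N hN x
    refine (hN x).trans ?_
    gcongr
    have : (fun y : Config n m => empirical y k) = siteAverage fun a => if a = k then 1 else 0 :=
      funext fun y => empirical_eq_siteAverage y k
    rw [this, empirical_eq_siteAverage]
    refine carre_du_champ_siteAverage_le (fun a b => ?_) x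
    split_ifs <;> simp
  -- Global Euler error, with `12` the Lipschitz constant and `6` the bound of the cut-off drift.
  have heuler : ∀ᶠ N : ℕ in atTop, (N : ℝ) * (12 * 6 * (T / N) ^ 2) ≤ δ := by
    have h1 : Tendsto (fun N : ℕ => 12 * 6 * (T : ℝ) ^ 2 / N) atTop (𝓝 0) :=
      tendsto_const_div_atTop_nhds_zero_nat _
    filter_upwards [h1.eventually_le_const hδ, eventually_gt_atTop 0] with N h2 hN
    have : (N : ℝ) ≠ 0 := by positivity
    refine le_of_eq_of_le ?_ h2
    field_simp
  filter_upwards [hsg, hvar, heuler, eventually_gt_atTop 0] with N hsg hvar heuler hN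
  have hN' : (0 : ℝ) < N := by exact_mod_cast hN
  set h : ℝ≥0 := T / N with hh
  have hcoe : (h : ℝ) = T / N := by simp [hh]
  rw [← hcoe] at heuler
  simp only [← hcoe] at hsg hvar
  set A : ℕ → Set Ω := fun k => {ω | ∃ i ≤ N, ε ≤ |∑ j ∈ Finset.range i,
      (empirical (η ((j + 1 : ℕ) * h) ω) k
        - semigroup n m h (fun y => empirical y k) (η (j * h) ω))|} with hA
  have hAle : ∀ k ∈ Finset.range (K + 1), P (A k) ≤
      ENNReal.ofReal ((T * (4 / n) + δ) / ε ^ 2) := by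
    intro k hk
    have := hη.measure_max_dynkin_le (fun y => empirical y k) h
      (v := (T * (4 / n) + δ) / N) (fun x => by
        rw [le_div_iff₀' hN']
        exact hvar k hk x) N hε
    rwa [mul_div_cancel₀ _ hN'.ne'] at this
  have hsub : {ω | ∃ i ≤ N, fluidError n m T K ε₀ ε δ <
        ‖empirical (η (i * h) ω) - u ((i * h : ℝ≥0) : ℝ)‖} ⊆
      {ω | ENNReal.ofReal ε₀ ≤ ‖empirical (η 0 ω) - q‖ₑ} ∪ ⋃ k ∈ Finset.range (K + 1), A k := by
    rintro ω ⟨i, hi, hlt⟩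
    by_contra hcon
    simp only [mem_union, mem_iUnion, not_or, not_exists, mem_ofPred_eq, not_le, hA, not_and]
      at hcon
    obtain ⟨h0, hM⟩ := hcon
    have h0' : ‖empirical (η 0 ω) - q‖ < ε₀ := by
      rwa [← ofReal_norm, ENNReal.ofReal_lt_ofReal_iff hε₀] at h0
    have hR : ∀ i ≤ N, _ := fun i (hi : i ≤ N) =>
      norm_empirical_sub_euler_le (fun j => η (j * h) ω) hN hK (T := T) (ε := ε) (δ := δ) T.coe_nonneg
        (fun k hk i hi => by
          rw [← hcoe]
          exact (hM k (Finset.mem_range.2 hk) i hi).le)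
        (fun k hk x => by
          rw [← hcoe]
          exact hsg k (Finset.mem_range.2 hk) x) hi
    rw [← hcoe] at hR
    have hmain := norm_sub_le_of_euler lipschitzWith_cutoffDrift norm_cutoffDrift_le hu h.coe_nonneg
      (fun j => empirical (η (j * h) ω)) hR hi
    refine absurd hlt (not_lt.2 ?_)
    push_cast
    refine hmain.trans ?_
    have hNh : (N : ℝ) * h = T := by rw [hcoe, mul_div_cancel₀ _ hN'.ne']
    rw [fluidError, hNh]
    simp only [Nat.cast_zero, zero_mul, hu0]
    push_cast
    gcongr
  refine (measure_mono hsub).trans ((measure_union_le _ _).trans (add_le_add le_rfl ?_))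
  refine (measure_biUnion_finset_le _ _).trans ((Finset.sum_le_sum hAle).trans (le_of_eq ?_))
  rw [Finset.sum_const, Finset.card_range, nsmul_eq_mul]
  push_cast
  rfl

/-- Exceeding a level strictly is an open condition, so by right-continuity it persists just after
`t` and is seen on a fine dyadic grid. The dyadic events increase, so the grid bound passes to their
union. -/
theorem IsZeroRangeProcess.measure_sup_le (hη : IsZeroRangeProcess n m P η)
    (hu0 : u 0 = q) (hu : ∀ t, 0 ≤ t → HasDerivWithinAt u (cutoffDrift (u t)) (Ici 0) t)
    {T : ℝ≥0} (hT : 0 < T) {K : ℕ} (hK : 0 < K) {ε₀ ε δ : ℝ} (hε₀ : 0 < ε₀) (hε : 0 < ε)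
    (hδ : 0 < δ) :
    P {ω | ∃ t ≤ T, fluidError n m T K ε₀ ε δ < ‖empirical (η t ω) - u t‖} ≤
      P {ω | ENNReal.ofReal ε₀ ≤ ‖empirical (η 0 ω) - q‖ₑ}
        + (K + 1) * ENNReal.ofReal ((T * (4 / n) + δ) / ε ^ 2) := by
  set E := fluidError n m T K ε₀ ε δ
  set B : ℕ → Set Ω := fun N => {ω | ∃ i ≤ N, E <
    ‖empirical (η (i * (T / N)) ω) - u ((i * (T / N) : ℝ≥0) : ℝ)‖} with hB
  have hmono : Monotone fun l => B (2 ^ l) := by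
    refine monotone_nat_of_le_succ fun l => ?_
    rintro ω ⟨i, hi, hlt⟩
    refine ⟨2 * i, by rw [pow_succ']; gcongr, ?_⟩
    have : ((2 * i : ℕ) : ℝ≥0) * (T / (2 ^ (l + 1) : ℕ)) = i * (T / (2 ^ l : ℕ)) := by
      push_cast
      rw [pow_succ']
      field_simp
    rwa [this]
  have hsub : {ω | ∃ t ≤ T, E < ‖empirical (η t ω) - u t‖} ⊆ ⋃ l, B (2 ^ l) := by
    rintro ω ⟨t, htT, hlt⟩
    have hcu : ContinuousWithinAt (fun s : ℝ≥0 => u s) (Ici t) t :=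
      ((hu t t.coe_nonneg).continuousWithinAt.comp NNReal.continuous_coe.continuousWithinAt
        fun s _ => s.coe_nonneg)
    have hcη : ContinuousWithinAt (fun s : ℝ≥0 => empirical (η s ω)) (Ici t) t :=
      (continuous_of_discreteTopology (f := fun x : Config n m => empirical x)).continuousAt
        |>.comp_continuousWithinAt (hη.rightContinuous ω t)
    have hev : ∀ᶠ s in 𝓝[≥] t, E < ‖empirical (η s ω) - u s‖ :=
      ((hcη.sub hcu).norm).eventually_const_lt hlt
    obtain ⟨b, hb, hbsub⟩ := mem_nhdsGE_iff_exists_Ico_subset.1 hev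
    have htend : Tendsto (fun l : ℕ => t + T / 2 ^ l) atTop (𝓝 t) := by
      have h1 : Tendsto (fun l : ℕ => T * (2⁻¹ : ℝ≥0) ^ l) atTop (𝓝 (T * 0)) :=
        (NNReal.tendsto_pow_atTop_nhds_zero_of_lt_one (by
          rw [← NNReal.coe_lt_coe]; norm_num)).const_mul T
      simpa [div_eq_mul_inv] using h1.const_add t
    obtain ⟨l, hl⟩ := (htend.eventually_lt_const hb).exists
    have hpos : (0 : ℝ≥0) < T / 2 ^ l := by positivity
    -- Rounding `t` up to the grid overshoots by at most one step and never passes `T`, which is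
    -- itself a grid point.
    refine mem_iUnion.2 ⟨l, ⌈t / (T / 2 ^ l)⌉₊, ?_, hbsub ⟨?_, ?_⟩⟩
    · refine Nat.ceil_le.2 ?_
      rw [div_le_iff₀ hpos]
      push_cast
      rwa [mul_div_cancel₀ _ (by positivity)]
    · push_cast
      rw [← div_le_iff₀ hpos]
      exact Nat.le_ceil _
    · push_cast
      refine lt_of_le_of_lt ?_ hl
      have h2 := (Nat.ceil_lt_add_one (zero_le : 0 ≤ t / (T / 2 ^ l))).le
      calc (⌈t / (T / 2 ^ l)⌉₊ : ℝ≥0) * (T / 2 ^ l) ≤ (t / (T / 2 ^ l) + 1) * (T / 2 ^ l) := by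
            gcongr
        _ = t + T / 2 ^ l := by
            rw [add_mul, div_mul_cancel₀ _ hpos.ne', one_mul]
  refine (measure_mono hsub).trans ?_
  rw [hmono.measure_iUnion]
  refine iSup_le fun l => ?_
  have hev := (tendsto_pow_atTop_atTop_of_one_lt (one_lt_two : (1 : ℕ) < 2)).eventually
    (hη.eventually_measure_grid_le hu0 hu T hK hε₀ hε hδ)
  obtain ⟨l', hl', hle⟩ := (hev.and (eventually_ge_atTop l)).exists
  exact (measure_mono (hmono hle)).trans hl'

end Fixed

/-! ### The fluid limit -/

/-- A solution of the cut-off fluid equation is the limit of the empirical distributions. -/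
theorem tendstoZeroInProb_of_cutoff
    {n m : ℕ → ℕ} {ρ : ℝ} (hn : Tendsto n atTop atTop)
    (hm : Tendsto (fun k => (m k : ℝ) / (n k : ℝ)) atTop (𝓝 ρ))
    {Ω : ℕ → Type*} [∀ k, MeasurableSpace (Ω k)]
    {P : ∀ k, Measure (Ω k)} [∀ k, IsProbabilityMeasure (P k)]
    {η : ∀ k, ℝ≥0 → Ω k → Config (n k) (m k)}
    (hη : ∀ k, IsZeroRangeProcess (n k) (m k) (P k) (η k)) {q : EllOne}
    (hQ : TendstoZeroInProb P (fun k ω => ‖empirical (η k 0 ω) - q‖ₑ)) {u : ℝ → EllOne}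
    (hu0 : u 0 = q) (hu : ∀ t, 0 ≤ t → HasDerivWithinAt u (cutoffDrift (u t)) (Ici 0) t)
    (T : ℝ≥0) :
    TendstoZeroInProb P
      (fun k ω => ⨆ t ∈ Icc (0 : ℝ≥0) T, ‖empirical (η k t ω) - u (t : ℝ)‖ₑ) := by
  intro ε hε
  obtain ⟨r, hr0, hrε⟩ := ENNReal.lt_iff_exists_nnreal_btwn.1 hε
  replace hr0 : (0 : ℝ) < r := by exact_mod_cast hr0
  -- A strictly positive horizon, so that `T = 0` needs no separate treatment.
  set S : ℝ≥0 := T + 1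
  -- The factor undoes the Gronwall exponential. Initial error, martingales and tail then use less
  -- than `a / 4` or exactly `a / 4` each, leaving room for the terms that vanish with `n`,
  -- including `δ = 1 / n`.
  set a : ℝ := r * Real.exp (-(12 * S)) with ha
  have ha0 : 0 < a := mul_pos hr0 (Real.exp_pos _)
  have haS : a * Real.exp (12 * S) = r := by
    rw [ha, mul_assoc, ← Real.exp_add, neg_add_cancel, Real.exp_zero, mul_one]
  obtain ⟨K, hKpos, hK⟩ : ∃ K : ℕ, 0 < K ∧ (2 + 4 * (S : ℝ)) * (ρ / K) < a / 4 := by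
    have h1 : Tendsto (fun K : ℕ => (2 + 4 * (S : ℝ)) * (ρ / K)) atTop
        (𝓝 ((2 + 4 * (S : ℝ)) * 0)) := (tendsto_const_div_atTop_nhds_zero_nat ρ).const_mul _
    rw [mul_zero] at h1
    exact ((eventually_gt_atTop 0).and (h1.eventually_lt_const (by positivity))).exists
  set ε₁ : ℝ := a / 4 / (K + 1) with hε₁
  have hε₁0 : 0 < ε₁ := by positivity
  have hinv : Tendsto (fun k => ((n k : ℝ))⁻¹) atTop (𝓝 0) :=
    (tendsto_inv_atTop_nhds_zero_nat (𝕜 := ℝ)).comp hn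
  have hE : Tendsto (fun k => fluidError (n k) (m k) S K (a / 4) ε₁ ((n k : ℝ))⁻¹) atTop
      (𝓝 ((a / 4 + ((K + 1) * (ε₁ + (0 + S * (2 * 0))) + (2 + 4 * S) * (ρ / K)) + 0)
        * Real.exp (12 * S))) := by
    simp only [fluidError, div_eq_mul_inv (2 : ℝ)]
    exact ((((((hinv.add ((hinv.const_mul 2).const_mul (S : ℝ))).const_add ε₁).const_mul
      ((K : ℝ) + 1)).add ((hm.div_const (K : ℝ)).const_mul (2 + 4 * (S : ℝ)))).const_add
      (a / 4)).add hinv).mul_const _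
  have hElt : (a / 4 + ((K + 1) * (ε₁ + (0 + S * (2 * 0))) + (2 + 4 * S) * (ρ / K)) + 0)
        * Real.exp (12 * S) < r := by
    rw [← haS]
    refine mul_lt_mul_of_pos_right ?_ (Real.exp_pos _)
    have : ((K : ℝ) + 1) * ε₁ = a / 4 := by rw [hε₁]; field_simp
    simp only [mul_zero, add_zero, this]
    linarith
  have hbound : Tendsto (fun k => P k {ω | ENNReal.ofReal (a / 4) ≤ ‖empirical (η k 0 ω) - q‖ₑ}
      + (K + 1) * ENNReal.ofReal ((S * (4 / n k) + ((n k : ℝ))⁻¹) / ε₁ ^ 2)) atTop (𝓝 0) := by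
    have h1 := hQ (ENNReal.ofReal (a / 4)) (by simpa using ha0)
    have h2 : Tendsto (fun k => (S * (4 / n k) + ((n k : ℝ))⁻¹) / ε₁ ^ 2) atTop (𝓝 0) := by
      have := ((((hinv.const_mul 4).const_mul (S : ℝ)).add hinv).div_const (ε₁ ^ 2))
      simpa [div_eq_mul_inv] using this
    have h3 := ENNReal.Tendsto.const_mul (a := (K : ℝ≥0∞) + 1) (ENNReal.tendsto_ofReal h2)
      (Or.inr (by simp))
    simpa using h1.add h3
  refine tendsto_of_tendsto_of_tendsto_of_le_of_le' tendsto_const_nhds hbound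
    (Eventually.of_forall fun _ => zero_le) ?_
  filter_upwards [hE.eventually_lt_const hElt, hn.eventually_gt_atTop 0] with k hk hnk
  refine (measure_mono fun ω hω => ?_).trans ((hη k).measure_sup_le hu0 hu
    (T := S) (by positivity) hKpos (ε₀ := a / 4) (by positivity) hε₁0
    (δ := ((n k : ℝ))⁻¹) (by positivity))
  by_contra hcon
  simp only [mem_ofPred_eq, not_exists, not_and, not_lt] at hcon
  refine absurd hω (not_le.2 (lt_of_le_of_lt ?_ hrε))
  refine iSup₂_le fun t ht => ?_
  rw [← ofReal_norm, ← ENNReal.ofReal_coe_nnreal]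
  exact ENNReal.ofReal_le_ofReal
    ((hcon t (ht.2.trans (le_add_of_nonneg_right zero_le_one))).trans hk.le)

end ZeroRange

end

/-! ### Removal of the cut-off -/

theorem proposition3
    (n m : ℕ → ℕ) (ρ : ℝ) (hρ : 0 < ρ)
    (hn : Tendsto n atTop atTop)
    (hm : Tendsto (fun k => (m k : ℝ) / (n k : ℝ)) atTop (𝓝 ρ))
    {Ω : ℕ → Type*} [∀ k, MeasurableSpace (Ω k)]
    (P : ∀ k, Measure (Ω k)) [∀ k, IsProbabilityMeasure (P k)]
    (η : ∀ k, ℝ≥0 → Ω k → ZeroRange.Config (n k) (m k))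
    (hη : ∀ k, ZeroRange.IsZeroRangeProcess (n k) (m k) (P k) (η k))
    (q : ZeroRange.EllOne) (hq_nonneg : ∀ j, 0 ≤ q j) (hq_sum : HasSum (fun j => q j) 1)
    (hQ : ZeroRange.TendstoZeroInProb P
      (fun k ω => ‖ZeroRange.empirical (η k 0 ω) - q‖ₑ)) :
    ∃ 𝔮 : ℝ → ZeroRange.EllOne,
      ZeroRange.IsFluidSolution q 𝔮 ∧
      (∀ 𝔯 : ℝ → ZeroRange.EllOne, ZeroRange.IsFluidSolution q 𝔯 → EqOn 𝔯 𝔮 (Ici 0)) ∧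
      ∀ T : ℝ≥0, ZeroRange.TendstoZeroInProb P
        (fun k ω => ⨆ t ∈ Icc (0 : ℝ≥0) T,
          ‖ZeroRange.empirical (η k t ω) - 𝔮 (t : ℝ)‖ₑ) := by
  obtain ⟨u, hu0, hu⟩ := ZeroRange.exists_global_solution ZeroRange.lipschitzWith_cutoffDrift
    ZeroRange.norm_cutoffDrift_le q
  have hlim := ZeroRange.tendstoZeroInProb_of_cutoff hn hm hη hQ hu0 hu
  -- An event of probability less than one misses some `ω`; there `u t` is within `ε` of an
  -- empirical distribution, whose norm is at most one.
  have hnorm : ∀ t, 0 ≤ t → ‖u t‖ ≤ 1 := by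
    intro t ht
    refine le_of_forall_pos_le_add fun ε hε => ?_
    obtain ⟨k, hk⟩ := ((hlim ⟨t, ht⟩ (ENNReal.ofReal ε)
      (ENNReal.ofReal_pos.2 hε)).eventually_lt_const zero_lt_one).exists
    obtain ⟨ω, hω⟩ : ∃ ω, ¬ ENNReal.ofReal ε ≤ ⨆ s ∈ Icc (0 : ℝ≥0) ⟨t, ht⟩,
        ‖ZeroRange.empirical (η k s ω) - u (s : ℝ)‖ₑ := by
      by_contra! hcon
      simp [hcon] at hk
    have h1 : ‖ZeroRange.empirical (η k ⟨t, ht⟩ ω) - u t‖ₑ < ENNReal.ofReal ε :=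
      lt_of_le_of_lt (le_iSup₂_of_le (⟨t, ht⟩ : ℝ≥0) ⟨zero_le, le_rfl⟩ le_rfl) (not_le.1 hω)
    rw [← ofReal_norm, ENNReal.ofReal_lt_ofReal_iff hε, norm_sub_rev] at h1
    linarith [norm_le_norm_add_norm_sub' (u t) (ZeroRange.empirical (η k ⟨t, ht⟩ ω)),
      ZeroRange.norm_empirical_le (η k ⟨t, ht⟩ ω)]
  have hsol : ZeroRange.IsFluidSolution q u := ⟨hu0, fun t ht => by
    have := hu t ht
    rwa [ZeroRange.cutoffDrift_of_norm_le (hnorm t ht)] at this⟩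
  exact ⟨u, hsol, fun r hr => hr.eqOn hsol, hlim⟩
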